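/- Let $N_j,M_j$ ($j=1,\dots,4$), $L$, $K_5,L_5,M_5$ be natural numbers with $L_5+K_5=M_5+1$. Let $T_j\in\mathbb C^{M_j\times N_j}$ and $F_j,Q_j\in\mathbb C^{N_j\times N_j}$ ($j\le 4$), let $\omega_{l,n}\in\mathbb R$ ($1\le l\le L$, $1\le n\le 5$) be angular frequencies, $\gamma_l\in\mathbb C\setminus\{0\}$ path gains, and $\Phi_{l,n}=e^{\mathrm i\omega_{l,n}}$. Write $\dagger$ for the Moore–Penrose inverse, $\otimes$ for the Kronecker and $\odot$ for the Khatri–Rao product, $b_l$ for the $l$-th column of $I_L$, and $A_n^{(m)}\in\mathbb C^{m\times L}$ for the matrix with entries $e^{\mathrm i(k-1)\omega_{l,n}}$, $1\le k\le m$, $1\le l\le L$. Put $B_j=T_j^{\mathrm H}A_j^{(M_j)}$, $$P=B_1\odot B_2\odot B_3\odot B_4\odot A_5^{(K_5)},\qquad G=A_5^{(L_5)},\qquad h=(B_1\odot B_2\odot B_3\odot B_4\odot A_5^{(M_5)})\gamma .$$ For $n\le4$ let $\breve J_{n,1}$ and $\breve J_{n,2}$ be $I_{N_1}\otimes\cdots\otimes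 I_{N_4}\otimes I_{K_5}$ with the $n$-th factor replaced by $Q_n$ and by $Q_nF_n^{\mathrm H}$ respectively; let $\breve J_{5,1}=I_{N_1N_2N_3N_4}\otimes[I_{K_5-1},0]$ and $\breve J_{5,2}=I_{N_1N_2N_3N_4}\otimes[0,I_{K_5-1}]$. For a vector $x\in\mathbb C^{N_1N_2N_3N_4M_5}$ let $\mathcal S(x)\in\mathbb C^{N_1N_2N_3N_4K_5\times L_5}$ be the frequency-smoothed matrix whose $\ell$-th column is $(I_{N_1N_2N_3N_4}\otimes[0_{K_5\times(\ell-1)},I_{K_5},0_{K_5\times(L_5-\ell)}])\,x$. Define $\lambda_{l,n}\in\mathbb C^{N_1N_2N_3N_4K_5}$ and $\chi_l\in\mathbb C^{L_5}$ by $$\lambda_{l,n}^{\mathrm H}=b_l^{\mathrm T}(\breve J_{n,1}P)^\dagger(\breve J_{n,2}-\Phi_{l,n}\breve J_{n,1}),\qquad \chi_l^*=(G^{\mathrm T})^\dagger b_l,$$ and let $\xi_{l,n}\in\mathbb C^{N_1N_2N_3N_4M_5}$ be the vector whose block (of length $M_5$) at each index $(n_1,n_2,n_3,n_4)$ is the convolution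 of the corresponding block (of length $K_5$) of $\lambda_{l,n}$ with $\chi_l$. (a) For all $l,n$ and every $\Delta h\in\mathbb C^{N_1N_2N_3N_4M_5}$, $$\frac1{\gamma_l}\,b_l^{\mathrm T}(\breve J_{n,1}P)^\dagger(\breve J_{n,2}-\Phi_{l,n}\breve J_{n,1})\,\mathcal S(\Delta h)\,(G^{\mathrm T})^\dagger b_l=\frac{\xi_{l,n}^{\mathrm H}\Delta h}{\gamma_l}.$$ (b) This is the first-order perturbation $\Delta\Phi_{l,n}$ of the eigenvalue $\Phi_{l,n}$ produced by the matrix-based beamspace ESPRIT algorithm. That algorithm, with weights $\beta_1,\dots,\beta_5\in\mathbb C$ and applied to an observation $\tilde h$, takes the $L$ leading left singular vectors $\tilde U_{\mathrm s}$ of $\mathcal S(\tilde h)$, forms $\tilde\Gamma_n=(\breve J_{n,1}\tilde U_{\mathrm s})^\dagger\breve J_{n,2}\tilde U_{\mathrm s}$, diagonalizes $\sum_n\beta_n\tilde\Gamma_n=\tilde E\tilde D\tilde E^{-1}$, and outputs the diagonal entries $\tilde\Phi_{l,n}$ of $\tilde E^{-1}\tilde\Gamma_n\tilde E$. Assume that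 for each $j\le4$ the matrix $F_j$ is non-singular, $[I_{M_j-1},0]T_j=[0,I_{M_j-1}]T_jF_j$, and $Q_j$ annihilates the last column of $T_j^{\mathrm H}$ and $F_j^{\mathrm H}$ times its first column; that $\breve J_{n,1}P$ ($n\le 5$) and $G$ have rank $L$; and that the numbers $\sum_n\beta_n\Phi_{l,n}$, $l=1,\dots,L$, are distinct. Then for all sufficiently small $\Delta h$ the algorithm has an output on $h+\Delta h$, and for every such output, after relabelling the paths by one permutation common to all $n$, $$\tilde\Phi_{l,n}=\Phi_{l,n}+\frac{\xi_{l,n}^{\mathrm H}\Delta h}{\gamma_l}+o(\|\Delta h\|)\qquad(\Delta h\to0),$$ uniformly over all choices of singular vectors and eigenvectors. -/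

import Mathlib

open scoped Matrix Kronecker Topology

namespace BeamspaceESPRIT

/-- The four Penrose equations: `X` is the Moore-Penrose inverse of `A`. -/
structure IsMoorePenrose {m n : Type*} [Fintype m] [Fintype n]
    (A : Matrix m n ℂ) (X : Matrix n m ℂ) : Prop where
  mul_mul_left : A * X * A = A
  mul_mul_right : X * A * X = X
  isHermitian_left : (A * X)ᴴ = A * X
  isHermitian_right : (X * A)ᴴ = X * A

open scoped ComplexOrder in
theorem exists_isMoorePenrose {m n : Type*} [Fintype m] [Fintype n] (A : Matrix m n ℂ) :
    ∃ X, IsMoorePenrose A X := by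
  classical
  have hS : (Aᴴ * A).IsHermitian := Matrix.isHermitian_conjTranspose_mul_self A
  set S := Aᴴ * A with hSdef
  obtain ⟨Z, h1, h2, h3, h4⟩ : ∃ Z : Matrix n n ℂ, S * Z * S = S ∧ Z * S * Z = Z ∧ Zᴴ = Z ∧
      S * Z = Z * S := by
    set U : Matrix n n ℂ := (hS.eigenvectorUnitary : Matrix n n ℂ) with hU
    have hUU : Uᴴ * U = 1 := by
      have := (Matrix.mem_unitaryGroup_iff').1 hS.eigenvectorUnitary.2
      simpa [Matrix.star_eq_conjTranspose] using this
    set d : n → ℂ := fun i => (hS.eigenvalues i : ℂ) with hd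
    have hsp : S = U * Matrix.diagonal d * Uᴴ := by
      have := hS.spectral_theorem
      simpa [Unitary.conjStarAlgAut_apply, Matrix.star_eq_conjTranspose, hd, hU,
        Function.comp_def] using this
    have key : ∀ a b : n → ℂ, (U * Matrix.diagonal a * Uᴴ) * (U * Matrix.diagonal b * Uᴴ)
        = U * Matrix.diagonal (fun i => a i * b i) * Uᴴ := by
      intro a b
      calc _ = U * Matrix.diagonal a * (Uᴴ * U) * Matrix.diagonal b * Uᴴ := by
            simp only [Matrix.mul_assoc]
        _ = _ := by
            rw [hUU, Matrix.mul_one, Matrix.mul_assoc U, Matrix.diagonal_mul_diagonal]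
    refine ⟨U * Matrix.diagonal (fun i => (d i)⁻¹) * Uᴴ, ?_, ?_, ?_, ?_⟩
    · rw [hsp, key, key]
      simp
    · rw [hsp, key, key]
      congr 3
      funext i
      by_cases h : d i = 0 <;> simp [h]
    · simp only [Matrix.conjTranspose_mul, Matrix.conjTranspose_conjTranspose,
        Matrix.diagonal_conjTranspose, Matrix.mul_assoc]
      congr 3
      funext i
      simp [hd]
    · rw [hsp, key, key]
      simp only [mul_comm]
  have h5 : A * (Z * S) = A := by
    have hSB : S * (Z * S - 1) = 0 := by
      rw [Matrix.mul_sub, ← Matrix.mul_assoc, h1, Matrix.mul_one, sub_self]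
    have h0 : (A * (Z * S - 1))ᴴ * (A * (Z * S - 1)) = 0 := by
      rw [Matrix.conjTranspose_mul, Matrix.mul_assoc, ← Matrix.mul_assoc Aᴴ, ← hSdef, hSB,
        Matrix.mul_zero]
    have h6 := Matrix.conjTranspose_mul_self_eq_zero.1 h0
    rwa [Matrix.mul_sub, Matrix.mul_one, sub_eq_zero] at h6
  have hZS : (Z * S)ᴴ = Z * S := by
    rw [Matrix.conjTranspose_mul, h3, hS.eq, h4]
  refine ⟨Z * Aᴴ, ?_, ?_, ?_, ?_⟩
  · rw [Matrix.mul_assoc, Matrix.mul_assoc, ← hSdef, h5]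
  · rw [Matrix.mul_assoc Z, ← hSdef, ← Matrix.mul_assoc, h2]
  · simp only [Matrix.conjTranspose_mul, Matrix.conjTranspose_conjTranspose, h3, Matrix.mul_assoc]
  · rw [Matrix.mul_assoc, ← hSdef, hZS]

theorem IsMoorePenrose.unique {m n : Type*} [Fintype m] [Fintype n] {A : Matrix m n ℂ}
    {X Y : Matrix n m ℂ} (hX : IsMoorePenrose A X) (hY : IsMoorePenrose A Y) : X = Y := by
  have e1 : A * X = A * Y := by
    calc A * X = (A * X)ᴴ := hX.isHermitian_left.symm
      _ = ((A * Y) * (A * X))ᴴ := by rw [← Matrix.mul_assoc, hY.mul_mul_left]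
      _ = (A * X) * (A * Y) := by
        rw [Matrix.conjTranspose_mul, hX.isHermitian_left, hY.isHermitian_left]
      _ = A * Y := by rw [← Matrix.mul_assoc, hX.mul_mul_left]
  have e2 : X * A = Y * A := by
    calc X * A = (X * A)ᴴ := hX.isHermitian_right.symm
      _ = ((X * A) * (Y * A))ᴴ := by
        rw [Matrix.mul_assoc X, ← Matrix.mul_assoc A, hY.mul_mul_left]
      _ = (Y * A) * (X * A) := by
        rw [Matrix.conjTranspose_mul, hX.isHermitian_right, hY.isHermitian_right]
      _ = Y * A := by rw [Matrix.mul_assoc Y, ← Matrix.mul_assoc A, hX.mul_mul_left]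
  calc X = X * A * X := hX.mul_mul_right.symm
    _ = Y * A * Y := by rw [e2, Matrix.mul_assoc, e1, ← Matrix.mul_assoc]
    _ = Y := hY.mul_mul_right

/-- The Moore-Penrose inverse. -/
noncomputable def pinv {m n : Type*} [Fintype m] [Fintype n] (A : Matrix m n ℂ) : Matrix n m ℂ :=
  Classical.choose (exists_isMoorePenrose A)

/-- Spatial (beam) multi-index `(n₁, n₂, n₃, n₄)`. -/
abbrev BeamIdx (N : Fin 4 → ℕ) : Type := (j : Fin 4) → Fin (N j)

/-- The five modes: `some j` is one of the four spatial modes, `none` is the frequency mode. -/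
abbrev Mode : Type := Option (Fin 4)

/-- The `m × L` Vandermonde matrix whose `l`-th column is the steering vector
`[1, exp (i θ_l), …, exp (i (m - 1) θ_l)]`. -/
noncomputable def steering (m : ℕ) {L : ℕ} (θ : Fin L → ℝ) : Matrix (Fin m) (Fin L) ℂ :=
  Matrix.of fun k l => Complex.exp (Complex.I * ((k : ℕ) : ℂ) * (θ l : ℂ))

/-- Selection matrix `[I, 0]` of size `(m - 1) × m`. -/
def selInit (m : ℕ) : Matrix (Fin (m - 1)) (Fin m) ℂ :=
  Matrix.of fun a b => if (b : ℕ) = a then 1 else 0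

/-- Selection matrix `[0, I]` of size `(m - 1) × m`. -/
def selTail (m : ℕ) : Matrix (Fin (m - 1)) (Fin m) ℂ :=
  Matrix.of fun a b => if (b : ℕ) = a + 1 then 1 else 0

/-- Shift invariance structure of the `M × N` beam matrix `T` with non-singular `F`, and
annihilation by `Q` of the vectors `t_M` and `Fᴴ t_1`; here `t_m` is the `m`-th column of `Tᴴ`. -/
structure IsShiftInvariant {M N : ℕ} (T : Matrix (Fin M) (Fin N) ℂ)
    (F Q : Matrix (Fin N) (Fin N) ℂ) : Prop where
  nonsingular : IsUnit F
  shift : selInit M * T = selTail M * T * F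
  annihilates_last : ∀ m : Fin M, (m : ℕ) + 1 = M → Q *ᵥ Tᴴ.col m = 0
  annihilates_first : ∀ m : Fin M, (m : ℕ) = 0 → Q *ᵥ (Fᴴ *ᵥ Tᴴ.col m) = 0

/-- Kronecker product `A₁ ⊗ A₂ ⊗ A₃ ⊗ A₄`, rows and columns labelled by multi-indices. -/
def kron4 {R C : Fin 4 → ℕ} (A : (j : Fin 4) → Matrix (Fin (R j)) (Fin (C j)) ℂ) :
    Matrix (BeamIdx R) (BeamIdx C) ℂ :=
  Matrix.of fun a b => ∏ j, A j (a j) (b j)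

/-- The Khatri-Rao product `B₁ ⊙ B₂ ⊙ B₃ ⊙ B₄ ⊙ A₅`, with `B_j = T_jᴴ A_j` the beamspace
manifold of the `j`-th spatial mode and `A₅` the `K × L` Vandermonde matrix of the frequency mode.
For `K = K₅` it is the matrix `P`. -/
noncomputable def manifold {N M : Fin 4 → ℕ} {L : ℕ}
    (T : (j : Fin 4) → Matrix (Fin (M j)) (Fin (N j)) ℂ) (ω : Mode → Fin L → ℝ) (K : ℕ) :
    Matrix (BeamIdx N × Fin K) (Fin L) ℂ :=
  Matrix.of fun a l =>
    (∏ j, ((T j)ᴴ * steering (M j) (ω (some j))) (a.1 j) l) * steering K (ω none) a.2 l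

/-- The noiseless beamspace channel vector. -/
noncomputable def channel {N M : Fin 4 → ℕ} {L : ℕ}
    (T : (j : Fin 4) → Matrix (Fin (M j)) (Fin (N j)) ℂ) (ω : Mode → Fin L → ℝ)
    (γ : Fin L → ℂ) (M₅ : ℕ) : BeamIdx N × Fin M₅ → ℂ :=
  manifold T ω M₅ *ᵥ γ

/-- The `K₅ × M₅` selection matrix `[0, I, 0]` with `s` leading zero columns. -/
def windowSel (K₅ M₅ s : ℕ) : Matrix (Fin K₅) (Fin M₅) ℂ :=
  Matrix.of fun k m => if (m : ℕ) = k + s then 1 else 0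

/-- Frequency smoothing: the column with (zero-based) index `s` is
`(I ⊗ I ⊗ I ⊗ I ⊗ [0, I, 0]) h`. -/
noncomputable def smooth {N : Fin 4 → ℕ} {M₅ : ℕ} (K₅ L₅ : ℕ) (h : BeamIdx N × Fin M₅ → ℂ) :
    Matrix (BeamIdx N × Fin K₅) (Fin L₅) ℂ :=
  Matrix.of fun a s =>
    (((1 : Matrix (BeamIdx N) (BeamIdx N) ℂ) ⊗ₖ windowSel K₅ M₅ (s : ℕ)) *ᵥ h) a

/-- Number of frequency rows kept by the selection matrices of a mode. -/
def freqRows (K₅ : ℕ) : Mode → ℕ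
  | some _ => K₅
  | none => K₅ - 1

/-- The first selection matrix of each mode, with `Q_j` in the `j`-th Kronecker factor for a
spatial mode and `[I, 0]` in the last factor for the frequency mode. -/
noncomputable def selOne {N : Fin 4 → ℕ} (Q : (j : Fin 4) → Matrix (Fin (N j)) (Fin (N j)) ℂ)
    (K₅ : ℕ) : (n : Mode) → Matrix (BeamIdx N × Fin (freqRows K₅ n)) (BeamIdx N × Fin K₅) ℂ
  | some j => kron4 (Function.update (fun _ => 1) j (Q j)) ⊗ₖ (1 : Matrix (Fin K₅) (Fin K₅) ℂ)
  | none => kron4 (fun _ => 1) ⊗ₖ selInit K₅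

/-- The second selection matrix of each mode, with `Q_j F_jᴴ` in the `j`-th Kronecker factor for a
spatial mode and `[0, I]` in the last factor for the frequency mode. -/
noncomputable def selTwo {N : Fin 4 → ℕ} (F Q : (j : Fin 4) → Matrix (Fin (N j)) (Fin (N j)) ℂ)
    (K₅ : ℕ) : (n : Mode) → Matrix (BeamIdx N × Fin (freqRows K₅ n)) (BeamIdx N × Fin K₅) ℂ
  | some j =>
    kron4 (Function.update (fun _ => 1) j (Q j * (F j)ᴴ)) ⊗ₖ (1 : Matrix (Fin K₅) (Fin K₅) ℂ)
  | none => kron4 (fun _ => 1) ⊗ₖ selTail K₅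

/-- The noiseless eigenvalues `Φ_{l,n} = exp (i ω_{l,n})`. -/
noncomputable def phase {L : ℕ} (ω : Mode → Fin L → ℝ) (n : Mode) (l : Fin L) : ℂ :=
  Complex.exp (Complex.I * (ω n l : ℂ))

/-- `A = U diag(σ) Vᴴ` is a (thin) singular value decomposition of `A`, with the singular values
in decreasing order. -/
structure IsSVD {m n : Type*} [Fintype m] [Fintype n] {r : ℕ} (A : Matrix m n ℂ)
    (U : Matrix m (Fin r) ℂ) (σ : Fin r → ℝ) (V : Matrix n (Fin r) ℂ) : Prop where
  orthonormal_left : Uᴴ * U = 1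
  orthonormal_right : Vᴴ * V = 1
  antitone : Antitone σ
  nonneg : ∀ i, 0 ≤ σ i
  eq : A = U * Matrix.diagonal (fun i => (σ i : ℂ)) * Vᴴ

/-- The columns of `Us` are the `L` leading left singular vectors of `A` (in some singular value
decomposition of `A`). -/
def IsLeadingLeft {m n : Type*} [Fintype m] [Fintype n] {L : ℕ} (A : Matrix m n ℂ)
    (Us : Matrix m (Fin L) ℂ) : Prop :=
  ∃ (r : ℕ) (hr : L ≤ r) (U : Matrix m (Fin r) ℂ) (σ : Fin r → ℝ) (V : Matrix n (Fin r) ℂ),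
    IsSVD A U σ V ∧ Us = U.submatrix id (Fin.castLE hr)

/-- The least-squares solution `(J_{n,1} U)† J_{n,2} U`. -/
noncomputable def gammaMat {N : Fin 4 → ℕ} {K₅ L : ℕ}
    (F Q : (j : Fin 4) → Matrix (Fin (N j)) (Fin (N j)) ℂ)
    (Us : Matrix (BeamIdx N × Fin K₅) (Fin L) ℂ) (n : Mode) : Matrix (Fin L) (Fin L) ℂ :=
  pinv (selOne Q K₅ n * Us) * (selTwo F Q K₅ n * Us)

/-- `Ψ` is a possible output of the matrix-based beamspace ESPRIT algorithm on the beamspace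
observation `h`, run with smoothing window sizes `K₅`, `L₅` and combining weights `β`: smooth `h`,
take the `L` leading left singular vectors, form the matrices `Γ_n`, diagonalize
`∑ β_n Γ_n = E D E⁻¹`, and read off the diagonals of `E⁻¹ Γ_n E`.
The singular vectors and the eigenvectors (in particular their order) are arbitrary. -/
def IsESPRITOutput {N : Fin 4 → ℕ} {M₅ L : ℕ} (K₅ L₅ : ℕ)
    (F Q : (j : Fin 4) → Matrix (Fin (N j)) (Fin (N j)) ℂ) (β : Mode → ℂ)
    (h : BeamIdx N × Fin M₅ → ℂ) (Ψ : Mode → Fin L → ℂ) : Prop :=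
  ∃ (Us : Matrix (BeamIdx N × Fin K₅) (Fin L) ℂ) (E : Matrix (Fin L) (Fin L) ℂ) (d : Fin L → ℂ),
    IsLeadingLeft (smooth K₅ L₅ h) Us ∧ IsUnit E ∧
    ∑ n, β n • gammaMat F Q Us n = E * Matrix.diagonal d * E⁻¹ ∧
    ∀ n l, Ψ n l = (E⁻¹ * gammaMat F Q Us n * E) l l

/-- `D n l Δh` is the first-order perturbation of the eigenvalue `Φ₀ n l` when the algorithm is run
on `h + Δh`: for every small `Δh` the algorithm has an output, and each of its outputs, up to the
labelling of the paths (the same one in all modes), is `Φ₀ n l + D n l Δh + o(‖Δh‖)`. -/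
def IsFirstOrderPerturbation {N : Fin 4 → ℕ} {M₅ L : ℕ} (K₅ L₅ : ℕ)
    (F Q : (j : Fin 4) → Matrix (Fin (N j)) (Fin (N j)) ℂ) (β : Mode → ℂ)
    (h : BeamIdx N × Fin M₅ → ℂ) (Φ₀ : Mode → Fin L → ℂ)
    (D : Mode → Fin L → (BeamIdx N × Fin M₅ → ℂ) → ℂ) : Prop :=
  ∀ ε : ℝ, 0 < ε → ∀ᶠ Δh in 𝓝 (0 : BeamIdx N × Fin M₅ → ℂ),
    (∃ Ψ : Mode → Fin L → ℂ, IsESPRITOutput K₅ L₅ F Q β (h + Δh) Ψ) ∧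
    ∀ Ψ : Mode → Fin L → ℂ, IsESPRITOutput K₅ L₅ F Q β (h + Δh) Ψ →
      ∃ σ : Equiv.Perm (Fin L), ∀ n l, ‖Ψ n (σ l) - Φ₀ n l - D n l Δh‖ ≤ ε * ‖Δh‖

/-- The row vector `λ_{l,n}ᴴ = b_lᵀ (J_{n,1} P)† (J_{n,2} - Φ_{l,n} J_{n,1})`. -/
noncomputable def lamH {N M : Fin 4 → ℕ} {L : ℕ}
    (T : (j : Fin 4) → Matrix (Fin (M j)) (Fin (N j)) ℂ)
    (F Q : (j : Fin 4) → Matrix (Fin (N j)) (Fin (N j)) ℂ) (ω : Mode → Fin L → ℝ) (K₅ : ℕ)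
    (n : Mode) (l : Fin L) : BeamIdx N × Fin K₅ → ℂ :=
  (Pi.single l 1 : Fin L → ℂ) ᵥ*
    (pinv (selOne Q K₅ n * manifold T ω K₅) * (selTwo F Q K₅ n - phase ω n l • selOne Q K₅ n))

/-- The vector `λ_{l,n}`. -/
noncomputable def lam {N M : Fin 4 → ℕ} {L : ℕ}
    (T : (j : Fin 4) → Matrix (Fin (M j)) (Fin (N j)) ℂ)
    (F Q : (j : Fin 4) → Matrix (Fin (N j)) (Fin (N j)) ℂ) (ω : Mode → Fin L → ℝ) (K₅ : ℕ)
    (n : Mode) (l : Fin L) : BeamIdx N × Fin K₅ → ℂ :=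
  star (lamH T F Q ω K₅ n l)

/-- The vector `χ_l^* = (Gᵀ)† b_l`, where `G` is the `L₅ × L` Vandermonde matrix of the frequency
mode. -/
noncomputable def chiConj {L : ℕ} (ω : Mode → Fin L → ℝ) (L₅ : ℕ) (l : Fin L) : Fin L₅ → ℂ :=
  pinv (steering L₅ (ω none))ᵀ *ᵥ (Pi.single l 1 : Fin L → ℂ)

/-- The vector `χ_l`. -/
noncomputable def chi {L : ℕ} (ω : Mode → Fin L → ℝ) (L₅ : ℕ) (l : Fin L) : Fin L₅ → ℂ :=
  star (chiConj ω L₅ l)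

/-- The (full, linear) convolution of two finite vectors, as a vector of length `m`; for vectors
of lengths `p` and `q` the full length is `m = p + q - 1`. -/
def conv {p q : ℕ} (m : ℕ) (a : Fin p → ℂ) (b : Fin q → ℂ) : Fin m → ℂ :=
  fun i => ∑ k : Fin p, ∑ s : Fin q, if (k : ℕ) + s = i then a k * b s else 0

/-- The vector `ξ_{l,n}`: its block at each beam index is the convolution of the block of
`λ_{l,n}` with `χ_l`. -/
noncomputable def xi {N M : Fin 4 → ℕ} {L : ℕ}
    (T : (j : Fin 4) → Matrix (Fin (M j)) (Fin (N j)) ℂ)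
    (F Q : (j : Fin 4) → Matrix (Fin (N j)) (Fin (N j)) ℂ) (ω : Mode → Fin L → ℝ)
    (K₅ L₅ M₅ : ℕ) (n : Mode) (l : Fin L) : BeamIdx N × Fin M₅ → ℂ :=
  fun a => conv M₅ (fun k => lam T F Q ω K₅ n l (a.1, k)) (chi ω L₅ l) a.2

/-- The bilinear expression
`γ_l⁻¹ b_lᵀ (J_{n,1} P)† (J_{n,2} - Φ_{l,n} J_{n,1}) ΔH (Gᵀ)† b_l` with `ΔH` the smoothed `Δh`. -/
noncomputable def bilinearPerturbation {N M : Fin 4 → ℕ} {L M₅ : ℕ}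
    (T : (j : Fin 4) → Matrix (Fin (M j)) (Fin (N j)) ℂ)
    (F Q : (j : Fin 4) → Matrix (Fin (N j)) (Fin (N j)) ℂ) (ω : Mode → Fin L → ℝ)
    (γ : Fin L → ℂ) (K₅ L₅ : ℕ) (n : Mode) (l : Fin L) (Δh : BeamIdx N × Fin M₅ → ℂ) : ℂ :=
  1 / γ l * ((Pi.single l 1 : Fin L → ℂ) ⬝ᵥ
    ((pinv (selOne Q K₅ n * manifold T ω K₅) * (selTwo F Q K₅ n - phase ω n l • selOne Q K₅ n) *
      smooth K₅ L₅ Δh * pinv (steering L₅ (ω none))ᵀ) *ᵥ (Pi.single l 1 : Fin L → ℂ)))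

end BeamspaceESPRIT

/-! Part (a) is a reindexing of a finite sum: the smoothed matrix has entry `Δh (b, k + s)` at row
`(b, k)` and column `s`, so pairing it with `lamH` and `chiConj` collects the products with `k + s`
fixed, which is a convolution (`bilinearPerturbation_eq`).

For part (b), smoothing is linear and sends the noiseless channel to `P * Y` with `Y = diagonal γ *
Gᵀ` (`smooth_channel`), where `G` is the `L₅ × L` Vandermonde matrix. Let `Δ` be the smoothed
perturbation and `W` the right inverse `(Gᵀ)† diag(γ⁻¹)` of `Y`. Instead of perturbing singular
vectors, the proof perturbs a convenient basis of their span. Truncating the SVD of `A = P * Y + Δ`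
gives `A = U * S + R`, where `‖R‖ ≤ ‖Δ‖` by Eckart–Young and `R * Aᴴ = R * Rᴴ`. Since `W = (P * Y)ᴴ
* Z` for some `Z`, one gets `R * W = (R * Rᴴ - R * Δᴴ) * Z`, which is quadratic in `Δ`. Hence `U *
(S * W) = P + Δ * W + O(‖Δ‖²)` for every admissible `U` (`IsLeadingLeft.exists_basis_near`); no gaps
between singular values enter, and the bound is uniform in `U`.

A change of basis conjugates every `Γ_n` by the same matrix (`pinv_mul_eq_conj`), and the diagonals
of `E⁻¹ Γ_n E` do not see this once `E` is changed accordingly. So `U` may be replaced by a matrix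
`X` close to `P`. Shift invariance, `J₂ P = J₁ P diag(φ)`, gives `Γ_n(X) = diag(φ) + pinv(J₁ X) (J₂
(X - P) - J₁ (X - P) diag(φ))` exactly, and continuity of the pseudoinverse at full column rank
linearizes it (`exists_pinv_mul_expansion`).

Finally, eigenvectors of a small perturbation of a diagonal matrix with distinct entries are, up to
order and scaling, the columns of `1 + Y'` with `Y'` small. Conjugation by `1 + Y'` changes the
diagonal of a nearly diagonal matrix only to second order, because the commutator of a diagonal
matrix with anything has zero diagonal (`norm_conj_diag_sub_le`, `eventually_diag_conj_near`). The
surviving linear term is the bilinear expression of part (a). -/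

namespace BeamspaceESPRIT

/-! ### Moore–Penrose inverses of matrices of full column or row rank. -/

section MoorePenrose

variable {m n : Type*} [Fintype m] [Fintype n]

theorem isMoorePenrose_pinv (A : Matrix m n ℂ) : IsMoorePenrose A (pinv A) :=
  Classical.choose_spec (exists_isMoorePenrose A)

theorem IsMoorePenrose.eq_pinv {A : Matrix m n ℂ} {X : Matrix n m ℂ} (h : IsMoorePenrose A X) :
    pinv A = X :=
  (isMoorePenrose_pinv A).unique h

/-- Places the columns of the pseudoinverse in the range of `Aᴴ`; this is what later makes the
residual term `R * W` quadratic. -/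
theorem pinv_eq_conjTranspose_mul (A : Matrix m n ℂ) :
    pinv A = Aᴴ * ((pinv A)ᴴ * pinv A) := by
  have h := isMoorePenrose_pinv A
  rw [← Matrix.mul_assoc, ← Matrix.conjTranspose_mul, h.isHermitian_right, h.mul_mul_right]

variable [DecidableEq n]

theorem pinv_mul_self_of_left_inverse {A : Matrix m n ℂ} {B : Matrix n m ℂ} (h : B * A = 1) :
    pinv A * A = 1 := by
  have h1 := (isMoorePenrose_pinv A).mul_mul_left
  calc pinv A * A = B * A * (pinv A * A) := by rw [h, Matrix.one_mul]
    _ = B * (A * pinv A * A) := by simp only [Matrix.mul_assoc]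
    _ = 1 := by rw [h1, h]

open scoped ComplexOrder in
theorem exists_left_inverse_of_rank {k : ℕ} {A : Matrix m (Fin k) ℂ} (h : A.rank = k) :
    ∃ B : Matrix (Fin k) m ℂ, B * A = 1 := by
  classical
  have hdet : IsUnit (Aᴴ * A) := by
    rw [← Matrix.mulVec_surjective_iff_isUnit]
    have hr : (Aᴴ * A).rank = k := (Matrix.rank_conjTranspose_mul_self A).trans h
    rw [Matrix.rank] at hr
    exact LinearMap.range_eq_top.1 (Submodule.eq_top_of_finrank_eq (by rw [hr]; simp))
  refine ⟨(Aᴴ * A)⁻¹ * Aᴴ, ?_⟩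
  rw [Matrix.mul_assoc, Matrix.nonsing_inv_mul _ ((Matrix.isUnit_iff_isUnit_det _).1 hdet)]

theorem transpose_mul_pinv_of_rank {k : ℕ} {A : Matrix m (Fin k) ℂ} (h : A.rank = k) :
    Aᵀ * pinv Aᵀ = 1 := by
  obtain ⟨B, hB⟩ := exists_left_inverse_of_rank h
  have hB' : Aᵀ * Bᵀ = 1 := by rw [← Matrix.transpose_mul, hB, Matrix.transpose_one]
  have h1 := (isMoorePenrose_pinv Aᵀ).mul_mul_left
  calc Aᵀ * pinv Aᵀ = Aᵀ * pinv Aᵀ * (Aᵀ * Bᵀ) := by rw [hB', Matrix.mul_one]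
    _ = Aᵀ * pinv Aᵀ * Aᵀ * Bᵀ := by simp only [Matrix.mul_assoc]
    _ = 1 := by rw [h1, hB']

theorem isUnit_conjTranspose_mul_self {A : Matrix m n ℂ} {B : Matrix n m ℂ} (h : B * A = 1) :
    IsUnit (Aᴴ * A) := by
  classical
  have hp := isMoorePenrose_pinv A
  have h1 := pinv_mul_self_of_left_inverse h
  have h2 : (pinv A * (pinv A)ᴴ) * (Aᴴ * A) = 1 := by
    calc _ = pinv A * ((A * pinv A)ᴴ * A) := by
          simp only [Matrix.conjTranspose_mul, Matrix.mul_assoc]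
      _ = 1 := by rw [hp.isHermitian_left, hp.mul_mul_left, h1]
  exact ⟨⟨Aᴴ * A, pinv A * (pinv A)ᴴ, mul_eq_one_comm.1 h2, h2⟩, rfl⟩

theorem pinv_eq_of_isUnit {A : Matrix m n ℂ} (h : IsUnit (Aᴴ * A)) :
    pinv A = (Aᴴ * A)⁻¹ * Aᴴ := by
  have hd := (Matrix.isUnit_iff_isUnit_det _).1 h
  have h1 : (Aᴴ * A)⁻¹ * Aᴴ * A = 1 := by rw [Matrix.mul_assoc, Matrix.nonsing_inv_mul _ hd]
  refine IsMoorePenrose.eq_pinv ⟨?_, ?_, ?_, ?_⟩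
  · rw [Matrix.mul_assoc A, h1, Matrix.mul_one]
  · rw [h1, Matrix.one_mul]
  · simp only [Matrix.conjTranspose_mul, Matrix.conjTranspose_conjTranspose,
      Matrix.conjTranspose_nonsing_inv, Matrix.mul_assoc]
  · rw [h1, Matrix.conjTranspose_one]

/-- The reverse-order law fails for general pseudoinverses; it holds here because `A * C` has the
same range projection as `A` and both have full column rank. -/
theorem pinv_mul_of_isUnit {A : Matrix m n ℂ} (h : IsUnit (Aᴴ * A)) {C : Matrix n n ℂ}
    (hC : IsUnit C) : pinv (A * C) = C⁻¹ * pinv A := by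
  have hp := isMoorePenrose_pinv A
  have hd := (Matrix.isUnit_iff_isUnit_det _).1 hC
  have h1 : pinv A * A = 1 := by
    rw [pinv_eq_of_isUnit h, Matrix.mul_assoc,
      Matrix.nonsing_inv_mul _ ((Matrix.isUnit_iff_isUnit_det _).1 h)]
  have h2 : A * C * (C⁻¹ * pinv A) = A * pinv A := by
    rw [Matrix.mul_assoc, ← Matrix.mul_assoc C, Matrix.mul_nonsing_inv _ hd, Matrix.one_mul]
  have h3 : C⁻¹ * pinv A * (A * C) = 1 := by
    rw [Matrix.mul_assoc, ← Matrix.mul_assoc (pinv A), h1, Matrix.one_mul,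
      Matrix.nonsing_inv_mul _ hd]
  refine IsMoorePenrose.eq_pinv ⟨?_, ?_, ?_, ?_⟩
  · rw [h2, ← Matrix.mul_assoc, hp.mul_mul_left]
  · rw [h3, Matrix.one_mul]
  · rw [h2, hp.isHermitian_left]
  · rw [h3, Matrix.conjTranspose_one]

end MoorePenrose

/-! ### Smoothing, the convolution identity and shift invariance of the manifold. -/

section Algebra

variable {N M : Fin 4 → ℕ} {L K₅ L₅ M₅ : ℕ}

theorem smooth_apply (h : BeamIdx N × Fin M₅ → ℂ) (a : BeamIdx N × Fin K₅) (s : Fin L₅)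
    (i : Fin M₅) (hi : (i : ℕ) = a.2 + s) : smooth K₅ L₅ h a s = h (a.1, i) := by
  simp only [smooth, Matrix.of_apply, Matrix.mulVec, dotProduct, Matrix.kroneckerMap_apply,
    windowSel, Fintype.sum_prod_type]
  rw [Finset.sum_eq_single a.1, Finset.sum_eq_single i]
  · simp [hi]
  · intro b _ hb
    have : (b : ℕ) ≠ a.2 + s := fun h => hb (Fin.ext (h.trans hi.symm))
    simp [this]
  · simp
  · intro b _ hb
    simp [Matrix.one_apply_ne' hb]
  · simp

theorem smooth_add (h g : BeamIdx N × Fin M₅ → ℂ) :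
    smooth K₅ L₅ (h + g) = smooth K₅ L₅ h + smooth K₅ L₅ g := by
  ext a s
  simp [smooth, Matrix.mulVec_add]

theorem smooth_smul (c : ℂ) (h : BeamIdx N × Fin M₅ → ℂ) :
    smooth K₅ L₅ (c • h) = c • smooth K₅ L₅ h := by
  ext a s
  simp [smooth, Matrix.mulVec_smul]

/-- The exponential `exp (i (k + s) ω)` splits into a row factor and a column factor, so smoothing a
sum of `L` paths gives a factorization through `L` dimensions. -/
theorem smooth_channel (hM₅ : L₅ + K₅ = M₅ + 1)
    (T : (j : Fin 4) → Matrix (Fin (M j)) (Fin (N j)) ℂ) (ω : Mode → Fin L → ℝ) (γ : Fin L → ℂ) :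
    smooth K₅ L₅ (channel T ω γ M₅) =
      manifold T ω K₅ * Matrix.diagonal γ * (steering L₅ (ω none))ᵀ := by
  ext a s
  have hlt : (a.2 : ℕ) + s < M₅ := by have := a.2.2; have := s.2; omega
  rw [smooth_apply _ a s ⟨a.2 + s, hlt⟩ rfl, channel, Matrix.mulVec, dotProduct, Matrix.mul_apply]
  refine Finset.sum_congr rfl fun l _ => ?_
  simp only [manifold, Matrix.of_apply, Matrix.mul_diagonal, Matrix.transpose_apply, steering,
    Nat.cast_add, mul_add, add_mul, Complex.exp_add]
  ring

theorem bilinearPerturbation_eq (hM₅ : L₅ + K₅ = M₅ + 1)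
    (T : (j : Fin 4) → Matrix (Fin (M j)) (Fin (N j)) ℂ)
    (F Q : (j : Fin 4) → Matrix (Fin (N j)) (Fin (N j)) ℂ)
    (ω : Mode → Fin L → ℝ) (γ : Fin L → ℂ) (n : Mode) (l : Fin L)
    (Δh : BeamIdx N × Fin M₅ → ℂ) :
    bilinearPerturbation T F Q ω γ K₅ L₅ n l Δh =
      (star (xi T F Q ω K₅ L₅ M₅ n l) ⬝ᵥ Δh) / γ l := by
  have key : (Pi.single l 1 : Fin L → ℂ) ⬝ᵥ
    ((pinv (selOne Q K₅ n * manifold T ω K₅) * (selTwo F Q K₅ n - phase ω n l • selOne Q K₅ n) *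
      smooth K₅ L₅ Δh * pinv (steering L₅ (ω none))ᵀ) *ᵥ (Pi.single l 1 : Fin L → ℂ)) =
      lamH T F Q ω K₅ n l ⬝ᵥ (smooth K₅ L₅ Δh *ᵥ chiConj ω L₅ l) := by
    rw [lamH, chiConj, ← Matrix.dotProduct_mulVec, Matrix.mulVec_mulVec, Matrix.mulVec_mulVec,
      Matrix.mul_assoc]
  rw [bilinearPerturbation, key, one_div_mul_eq_div]
  congr 1
  simp only [dotProduct, Matrix.mulVec, Fintype.sum_prod_type, xi, conv, lam, chi, Pi.star_apply,
    star_sum, Finset.mul_sum, Finset.sum_mul]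
  refine Finset.sum_congr rfl fun b _ => ?_
  rw [eq_comm, Finset.sum_comm]
  refine Finset.sum_congr rfl fun k _ => ?_
  rw [Finset.sum_comm]
  refine Finset.sum_congr rfl fun s _ => ?_
  -- The largest index is `(K₅ - 1) + (L₅ - 1) = M₅ - 1`, so every pair `(k, s)` hits exactly one
  -- entry of the block.
  have hlt : (k : ℕ) + s < M₅ := by have := k.2; have := s.2; omega
  rw [smooth_apply Δh (b, k) s ⟨k + s, hlt⟩ rfl, Finset.sum_eq_single ⟨k + s, hlt⟩]
  · simp only [if_true, star_mul', star_star]; ring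
  · intro i _ hi
    have : (k : ℕ) + s ≠ i := fun h => hi (Fin.ext h.symm)
    simp [this]
  · simp

theorem kron4_mul_prod {R C : Fin 4 → ℕ} (A : (j : Fin 4) → Matrix (Fin (R j)) (Fin (C j)) ℂ)
    (v : (j : Fin 4) → Fin (C j) → ℂ) (a : BeamIdx R) :
    ∑ b : BeamIdx C, kron4 A a b * ∏ j, v j (b j) = ∏ j, (A j *ᵥ v j) (a j) := by
  simp only [kron4, Matrix.of_apply, ← Finset.prod_mul_distrib, Matrix.mulVec, dotProduct]
  rw [Finset.prod_univ_sum]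
  simp [Fintype.piFinset_univ]

theorem kron4_kronecker_mul_manifold {R : Fin 4 → ℕ} {r K : ℕ}
    (T : (j : Fin 4) → Matrix (Fin (M j)) (Fin (N j)) ℂ) (ω : Mode → Fin L → ℝ)
    (A : (j : Fin 4) → Matrix (Fin (R j)) (Fin (N j)) ℂ) (B : Matrix (Fin r) (Fin K) ℂ)
    (a : BeamIdx R × Fin r) (l : Fin L) :
    ((kron4 A ⊗ₖ B) * manifold T ω K) a l =
      (∏ j, (A j *ᵥ ((T j)ᴴ * steering (M j) (ω (some j))).col l) (a.1 j)) *
        (B *ᵥ (steering K (ω none)).col l) a.2 := by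
  rw [← kron4_mul_prod, Matrix.mul_apply, Fintype.sum_prod_type, Finset.sum_mul]
  refine Finset.sum_congr rfl fun b _ => ?_
  simp only [Matrix.mulVec, dotProduct, Finset.mul_sum]
  refine Finset.sum_congr rfl fun k _ => ?_
  simp only [Matrix.kroneckerMap_apply, manifold, Matrix.of_apply, Matrix.col_apply]
  ring

theorem selTail_mulVec_steering (K : ℕ) (θ : Fin L → ℝ) (l : Fin L) :
    selTail K *ᵥ (steering K θ).col l =
      Complex.exp (Complex.I * (θ l : ℂ)) • (selInit K *ᵥ (steering K θ).col l) := by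
  funext a
  have ha := a.2
  simp only [Matrix.mulVec, dotProduct, selTail, selInit, Matrix.of_apply, Pi.smul_apply,
    smul_eq_mul, Matrix.col_apply, steering]
  rw [Finset.sum_eq_single ⟨a + 1, by omega⟩, Finset.sum_eq_single ⟨a, by omega⟩]
  · simp only [if_true, one_mul, Nat.cast_add, Nat.cast_one, ← Complex.exp_add]
    congr 1; ring
  · intro b _ hb
    have : (b : ℕ) ≠ a := fun h => hb (Fin.ext h)
    simp [this]
  · simp
  · intro b _ hb
    have : (b : ℕ) ≠ a + 1 := fun h => hb (Fin.ext h)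
    simp [this]
  · simp

/-- With `t_i` the columns of `Tᴴ`, the beamspace steering vector is `∑ exp (i θ)^i t_i`, and `Fᴴ`
moves `t_(i+1)` to `t_i`. The two boundary terms that spoil the shift, `Fᴴ t_0` and the last `t_i`,
are exactly those killed by `Q`. -/
theorem IsShiftInvariant.mulVec_steering {m k : ℕ} {T : Matrix (Fin m) (Fin k) ℂ}
    {F Q : Matrix (Fin k) (Fin k) ℂ} (h : IsShiftInvariant T F Q) (θ : Fin L → ℝ) (l : Fin L) :
    (Q * Fᴴ) *ᵥ (Tᴴ * steering m θ).col l =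
      Complex.exp (Complex.I * (θ l : ℂ)) • (Q *ᵥ (Tᴴ * steering m θ).col l) := by
  have expand : ∀ (A : Matrix (Fin k) (Fin k) ℂ), A *ᵥ (Tᴴ * steering m θ).col l =
      ∑ i : Fin m, steering m θ i l • (A *ᵥ Tᴴ.col i) := by
    intro A
    have : (Tᴴ * steering m θ).col l = ∑ i : Fin m, steering m θ i l • Tᴴ.col i := by
      funext b
      simp [Matrix.mul_apply, Finset.sum_apply, mul_comm]
    rw [this, Matrix.mulVec_sum]
    simp only [Matrix.mulVec_smul]
  rw [expand, expand]
  rcases m with _ | m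
  · simp
  have hshift : ∀ i : Fin m, Fᴴ *ᵥ Tᴴ.col i.succ = Tᴴ.col i.castSucc := by
    intro i
    funext b
    have h1 := congrFun (congrFun h.shift i) b
    rw [Matrix.mul_assoc, Matrix.mul_apply, Matrix.mul_apply, Finset.sum_eq_single i.castSucc,
      Finset.sum_eq_single i.succ] at h1
    · simp only [selInit, selTail, Matrix.of_apply, Fin.val_castSucc, Fin.val_succ, if_true,
        one_mul] at h1
      simp only [Matrix.col_apply, Matrix.conjTranspose_apply, h1, Matrix.mulVec, dotProduct,
        Matrix.mul_apply, star_sum, star_mul']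
      exact Finset.sum_congr rfl fun c _ => mul_comm _ _
    · intro c _ hc
      have : (c : ℕ) ≠ i + 1 := fun h => hc (Fin.ext h)
      simp [selTail, this]
    · simp
    · intro c _ hc
      have : (c : ℕ) ≠ i := fun h => hc (Fin.ext h)
      simp [selInit, this]
    · simp
  rw [Fin.sum_univ_succ, Fin.sum_univ_castSucc (fun i => steering (m + 1) θ i l • (Q *ᵥ Tᴴ.col i)),
    h.annihilates_last (Fin.last m) (by simp), ← Matrix.mulVec_mulVec,
    h.annihilates_first 0 (by simp)]
  simp only [← Matrix.mulVec_mulVec, hshift, smul_zero, add_zero, zero_add, Finset.smul_sum,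
    smul_smul]
  refine Finset.sum_congr rfl fun i _ => ?_
  congr 1
  simp only [steering, Matrix.of_apply, Fin.val_succ, Fin.val_castSucc, ← Complex.exp_add]
  congr 1
  push_cast
  ring

theorem selTwo_mul_manifold (T : (j : Fin 4) → Matrix (Fin (M j)) (Fin (N j)) ℂ)
    (F Q : (j : Fin 4) → Matrix (Fin (N j)) (Fin (N j)) ℂ) (ω : Mode → Fin L → ℝ)
    (h : ∀ j, IsShiftInvariant (T j) (F j) (Q j)) (n : Mode) :
    selTwo F Q K₅ n * manifold T ω K₅ =
      selOne Q K₅ n * manifold T ω K₅ * Matrix.diagonal (phase ω n) := by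
  ext a l
  rw [Matrix.mul_diagonal]
  cases n with
  | none =>
    have e1 := kron4_kronecker_mul_manifold T ω (fun _ => 1) (selTail K₅) a l
    have e2 := kron4_kronecker_mul_manifold T ω (fun _ => 1) (selInit K₅) a l
    refine e1.trans (Eq.trans ?_ (congrArg (· * phase ω none l) e2.symm))
    simp only [selTail_mulVec_steering, Pi.smul_apply, smul_eq_mul, phase]
    ring
  | some j =>
    have e1 := kron4_kronecker_mul_manifold T ω
      (Function.update (fun _ => 1) j (Q j * (F j)ᴴ)) (1 : Matrix (Fin K₅) (Fin K₅) ℂ) a l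
    have e2 := kron4_kronecker_mul_manifold T ω
      (Function.update (fun _ => 1) j (Q j)) (1 : Matrix (Fin K₅) (Fin K₅) ℂ) a l
    refine e1.trans (Eq.trans ?_ (congrArg (· * phase ω (some j) l) e2.symm))
    rw [← Finset.mul_prod_erase _ _ (Finset.mem_univ j),
      ← Finset.mul_prod_erase _ _ (Finset.mem_univ j)]
    have hne : ∀ A : Matrix (Fin (N j)) (Fin (N j)) ℂ, ∀ i ∈ Finset.univ.erase j,
        (Function.update (fun i => (1 : Matrix (Fin (N i)) (Fin (N i)) ℂ)) j A i *ᵥ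
          ((T i)ᴴ * steering (M i) (ω (some i))).col l) (a.1 i) =
        ((T i)ᴴ * steering (M i) (ω (some i))) (a.1 i) l := by
      intro A i hi
      rw [Function.update_of_ne (Finset.ne_of_mem_erase hi), Matrix.one_mulVec, Matrix.col_apply]
    rw [Finset.prod_congr rfl (hne _), Finset.prod_congr rfl (hne _)]
    simp only [Function.update_self, (h j).mulVec_steering, Pi.smul_apply, smul_eq_mul, phase]
    ring

end Algebra

/-! ### Existence of the SVD, and optimality of its truncation. -/

section SVD

variable {m n : Type*} [Fintype m] [Fintype n]

theorem exists_forall_pos_iff_lt_of_antitone {k : ℕ} {f : Fin k → ℝ} (hf : Antitone f) :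
    ∃ r ≤ k, ∀ i : Fin k, 0 < f i ↔ (i : ℕ) < r := by
  classical
  have hex : ∃ r, ∀ i : Fin k, r ≤ (i : ℕ) → ¬ 0 < f i :=
    ⟨k, fun i hi => absurd i.2 (not_lt.2 hi)⟩
  refine ⟨Nat.find hex, Nat.find_min' hex fun i hi => absurd i.2 (not_lt.2 hi), fun i =>
    ⟨fun h => ?_, fun h => ?_⟩⟩
  · by_contra hlt
    exact Nat.find_spec hex i (not_lt.1 hlt) h
  · have := Nat.find_min hex h
    push Not at this
    obtain ⟨j, hj, hpos⟩ := this
    exact hpos.trans_le (hf (Fin.le_def.2 hj))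

open scoped ComplexOrder in
-- Take `V` from the eigenvectors of `Aᴴ * A` with positive eigenvalue, `σ` the square roots, and `U
-- = A V Σ⁻¹`. Decreasing order makes the positive eigenvalues an initial segment.
theorem exists_isSVD (A : Matrix m n ℂ) :
    ∃ (r : ℕ) (U : Matrix m (Fin r) ℂ) (σ : Fin r → ℝ) (V : Matrix n (Fin r) ℂ),
      IsSVD A U σ V := by
  classical
  have hS : (Aᴴ * A).IsHermitian := Matrix.isHermitian_conjTranspose_mul_self A
  obtain ⟨r, hr, hpos⟩ := exists_forall_pos_iff_lt_of_antitone hS.eigenvalues₀_antitone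
  let e : Fin (Fintype.card n) ≃ n := Fintype.equivOfCardEq (Fintype.card_fin _)
  have hval : ∀ i, hS.eigenvalues (e i) = hS.eigenvalues₀ i := by
    intro i
    simp [Matrix.IsHermitian.eigenvalues, e]
  set W : Matrix n n ℂ := (hS.eigenvectorUnitary : Matrix n n ℂ) with hW
  have hWW : Wᴴ * W = 1 := by
    have := (Matrix.mem_unitaryGroup_iff').1 hS.eigenvectorUnitary.2
    simpa [Matrix.star_eq_conjTranspose] using this
  have hWW' : W * Wᴴ = 1 := mul_eq_one_comm.1 hWW
  have hsp : Aᴴ * A = W * Matrix.diagonal (fun i => (hS.eigenvalues i : ℂ)) * Wᴴ := by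
    have := hS.spectral_theorem
    simpa [Unitary.conjStarAlgAut_apply, Matrix.star_eq_conjTranspose, hW,
      Function.comp_def] using this
  have hG : (A * W)ᴴ * (A * W) = Matrix.diagonal (fun i => (hS.eigenvalues i : ℂ)) := by
    calc (A * W)ᴴ * (A * W) = Wᴴ * (Aᴴ * A) * W := by
          simp only [Matrix.conjTranspose_mul, Matrix.mul_assoc]
      _ = Wᴴ * (W * Matrix.diagonal (fun i => (hS.eigenvalues i : ℂ)) * Wᴴ) * W :=
          congrArg (fun Z => Wᴴ * Z * W) hsp
      _ = (Wᴴ * W) * Matrix.diagonal (fun i => (hS.eigenvalues i : ℂ)) * (Wᴴ * W) := by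
          simp only [Matrix.mul_assoc]
      _ = _ := by rw [hWW, Matrix.one_mul, Matrix.mul_one]
  let g : Fin r → n := fun i => e (Fin.castLE hr i)
  have hg : Function.Injective g := e.injective.comp (Fin.castLE_injective hr)
  have hgpos : ∀ i : Fin r, 0 < hS.eigenvalues (g i) := fun i => by
    rw [hval]; exact (hpos _).2 i.2
  let σ : Fin r → ℝ := fun i => Real.sqrt (hS.eigenvalues (g i))
  have hσpos : ∀ i, 0 < σ i := fun i => Real.sqrt_pos.2 (hgpos i)
  have hσne : ∀ i, (σ i : ℂ) ≠ 0 := fun i => Complex.ofReal_ne_zero.2 (hσpos i).ne'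
  have hσsq : ∀ i, (σ i : ℂ) * σ i = hS.eigenvalues (g i) := fun i => by
    rw [← Complex.ofReal_mul, Real.mul_self_sqrt (hgpos i).le]
  let V : Matrix n (Fin r) ℂ := W.submatrix id g
  have hAV : A * V = (A * W).submatrix id g := by
    ext i j; simp [V, Matrix.mul_apply]
  refine ⟨r, A * V * Matrix.diagonal (fun i => (σ i : ℂ)⁻¹), σ, V, ?_, ?_, ?_, ?_, ?_⟩
  · have h1 : (A * V)ᴴ * (A * V) = Matrix.diagonal (fun i => (σ i : ℂ) * σ i) := by
      rw [hAV, Matrix.conjTranspose_submatrix, ← Matrix.submatrix_mul _ _ _ _ _ Function.bijective_id,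
        hG, Matrix.submatrix_diagonal _ _ hg]
      simp only [hσsq, Function.comp_def]
    rw [Matrix.conjTranspose_mul, Matrix.mul_assoc, ← Matrix.mul_assoc (A * V)ᴴ, h1,
      Matrix.diagonal_conjTranspose, Matrix.diagonal_mul_diagonal, Matrix.diagonal_mul_diagonal,
      ← Matrix.diagonal_one]
    congr 1
    funext i
    have := hσne i
    simp only [Pi.star_apply, star_inv₀, RCLike.star_def, Complex.conj_ofReal]
    field_simp
  · rw [Matrix.conjTranspose_submatrix, ← Matrix.submatrix_mul _ _ _ _ _ Function.bijective_id, hWW,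
      Matrix.submatrix_one _ hg]
  · intro i j hij
    refine Real.sqrt_le_sqrt ?_
    rw [hval, hval]
    exact hS.eigenvalues₀_antitone (by simpa using hij)
  · exact fun i => (hσpos i).le
  · have h2 : A * V * Matrix.diagonal (fun i => (σ i : ℂ)⁻¹) * Matrix.diagonal (fun i => (σ i : ℂ))
        = A * V := by
      rw [Matrix.mul_assoc, Matrix.diagonal_mul_diagonal]
      simp [hσne]
    -- The squared length of column `j` of `A * W` is the eigenvalue `j`, so the discarded columns
    -- vanish and the thin factorization recovers all of `A`.
    have hker : ∀ j : n, j ∉ Set.range g → ∀ a, (A * W) a j = 0 := by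
      intro j hj
      have hz : hS.eigenvalues j = 0 := by
        obtain ⟨i, rfl⟩ := e.surjective j
        have h3 : ¬ 0 < hS.eigenvalues₀ i := fun h => hj ⟨⟨i, (hpos i).1 h⟩, by simp [g]⟩
        have h4 : 0 ≤ hS.eigenvalues (e i) :=
          (Matrix.posSemidef_conjTranspose_mul_self A).eigenvalues_nonneg _
        rw [hval] at h4 ⊢
        exact le_antisymm (not_lt.1 h3) h4
      have h5 := congrFun (congrFun hG j) j
      rw [Matrix.diagonal_apply_eq, hz, Matrix.mul_apply] at h5
      have h6 : ∑ a, ‖(A * W) a j‖ ^ 2 = 0 := by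
        have : ((∑ a, ‖(A * W) a j‖ ^ 2 : ℝ) : ℂ) = 0 := by
          rw [← Complex.ofReal_zero, ← h5]
          push_cast
          refine Finset.sum_congr rfl fun a _ => ?_
          rw [Matrix.conjTranspose_apply, RCLike.star_def, ← Complex.conj_mul']
        exact_mod_cast this
      intro a
      have := (Finset.sum_eq_zero_iff_of_nonneg fun a _ => sq_nonneg _).1 h6 a (Finset.mem_univ a)
      exact norm_eq_zero.1 (pow_eq_zero_iff two_ne_zero |>.1 this)
    rw [h2]
    calc A = A * W * Wᴴ := by rw [Matrix.mul_assoc, hWW', Matrix.mul_one]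
      _ = A * V * Vᴴ := by
        ext a b
        rw [hAV, Matrix.mul_apply, Matrix.mul_apply]
        simp only [Matrix.submatrix_apply, id, V, Matrix.conjTranspose_apply]
        rw [← Finset.sum_image (s := Finset.univ) (g := g)
          (f := fun j => (A * W) a j * star (W b j)) (fun _ _ _ _ h => hg h)]
        refine (Finset.sum_subset (Finset.subset_univ _) fun j _ hj => ?_).symm
        rw [hker j (by simpa using hj), zero_mul]

theorem IsSVD.rank_le {r : ℕ} {A : Matrix m n ℂ} {U : Matrix m (Fin r) ℂ} {σ : Fin r → ℝ}
    {V : Matrix n (Fin r) ℂ} (h : IsSVD A U σ V) : A.rank ≤ r := by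
  rw [h.eq, Matrix.mul_assoc]
  exact (Matrix.rank_mul_le_left _ _).trans ((Matrix.rank_le_card_width U).trans (by simp))

theorem exists_isLeadingLeft {L : ℕ} {A : Matrix m n ℂ} (h : L ≤ A.rank) :
    ∃ Us : Matrix m (Fin L) ℂ, IsLeadingLeft A Us := by
  obtain ⟨r, U, σ, V, hs⟩ := exists_isSVD A
  exact ⟨_, r, h.trans hs.rank_le, U, σ, V, hs, rfl⟩

open scoped Matrix.Norms.L2Operator

theorem l2_opNorm_le_one_of_isometry {r : ℕ} {U : Matrix m (Fin r) ℂ} (h : Uᴴ * U = 1) :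
    ‖U‖ ≤ 1 := by
  classical
  have h1 : ‖U‖ * ‖U‖ ≤ 1 := by
    rw [← Matrix.l2_opNorm_conjTranspose_mul_self, h, ← Matrix.diagonal_one,
      Matrix.l2_opNorm_diagonal]
    exact (pi_norm_le_iff_of_nonneg zero_le_one).2 fun _ => by simp
  nlinarith [norm_nonneg U]

/-- The lower bound of Eckart–Young: the first `L + 1` right singular vectors span a space on which
`Y`, having only `L` rows, must have a kernel. On that kernel `A - X * Y` agrees with `A`, which
stretches by at least `σ i`. -/
theorem IsSVD.singularValue_le [DecidableEq n] {r L : ℕ} {A : Matrix m n ℂ}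
    {U : Matrix m (Fin r) ℂ} {σ : Fin r → ℝ} {V : Matrix n (Fin r) ℂ} (h : IsSVD A U σ V)
    (X : Matrix m (Fin L) ℂ) (Y : Matrix (Fin L) n ℂ) (i : Fin r) (hi : L ≤ (i : ℕ)) :
    σ i ≤ ‖A - X * Y‖ := by
  classical
  rcases le_or_gt (σ i) 0 with hσ | hσ
  · exact hσ.trans (norm_nonneg _)
  let emb : Fin (L + 1) → Fin r := Fin.castLE (by have := i.2; omega)
  have hemb : Function.Injective emb := Fin.castLE_injective _
  have hσe : ∀ j, σ i ≤ σ (emb j) := fun j =>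
    h.antitone (Fin.le_def.2 (by have := j.2; simp only [emb, Fin.val_castLE]; omega))
  set V' := V.submatrix id emb with hV'
  set U' := U.submatrix id emb with hU'
  have hVV : V'ᴴ * V' = 1 := by
    rw [hV', Matrix.conjTranspose_submatrix, ← Matrix.submatrix_mul _ _ _ _ _ Function.bijective_id,
      h.orthonormal_right, Matrix.submatrix_one _ hemb]
  have hUU : U'ᴴ * U' = 1 := by
    rw [hU', Matrix.conjTranspose_submatrix, ← Matrix.submatrix_mul _ _ _ _ _ Function.bijective_id,
      h.orthonormal_left, Matrix.submatrix_one _ hemb]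
  -- The kernel vector is kept as a one-column matrix, so that one operator norm serves for all
  -- factors.
  obtain ⟨c, hc0, hc⟩ : ∃ c : Matrix (Fin (L + 1)) (Fin 1) ℂ, Y * V' * c = 0 ∧ c ≠ 0 := by
    have hker := LinearMap.ker_ne_bot_of_finrank_lt (f := (Y * V').mulVecLin) (by simp)
    obtain ⟨v, hv, hv0⟩ := (Submodule.ne_bot_iff _).1 hker
    refine ⟨Matrix.replicateCol (Fin 1) v, ?_, fun h => hv0 ?_⟩
    · ext a b
      exact congrFun (LinearMap.mem_ker.1 hv) a
    · funext a
      exact congrFun (congrFun h a) 0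
  have hAV : U'ᴴ * (A * V') = Matrix.diagonal fun j => (σ (emb j) : ℂ) := by
    have h1 : A * V = U * Matrix.diagonal (fun i => (σ i : ℂ)) := by
      rw [h.eq, Matrix.mul_assoc, h.orthonormal_right, Matrix.mul_one]
    have h2 : Uᴴ * (A * V) = Matrix.diagonal (fun i => (σ i : ℂ)) := by
      rw [h1, ← Matrix.mul_assoc, h.orthonormal_left, Matrix.one_mul]
    have h3 : U'ᴴ * (A * V') = (Uᴴ * (A * V)).submatrix emb emb := by
      ext a b; simp [U', V', Matrix.mul_apply]
    rw [h3, h2, Matrix.submatrix_diagonal _ _ hemb]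
    rfl
  have hne : ∀ j, (σ (emb j) : ℂ) ≠ 0 := fun j =>
    Complex.ofReal_ne_zero.2 (hσ.trans_le (hσe j)).ne'
  have hceq : c = Matrix.diagonal (fun j => (σ (emb j) : ℂ)⁻¹) *
      (U'ᴴ * ((A - X * Y) * (V' * c))) := by
    have h4 : (A - X * Y) * (V' * c) = A * V' * c := by
      rw [Matrix.sub_mul, Matrix.mul_assoc X, ← Matrix.mul_assoc Y, hc0, Matrix.mul_zero, sub_zero,
        Matrix.mul_assoc]
    rw [h4, ← Matrix.mul_assoc U'ᴴ, hAV, ← Matrix.mul_assoc, Matrix.diagonal_mul_diagonal]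
    simp [hne]
  have hd : ‖(Matrix.diagonal (fun j => (σ (emb j) : ℂ)⁻¹) :
      Matrix (Fin (L + 1)) (Fin (L + 1)) ℂ)‖ ≤ (σ i)⁻¹ := by
    rw [Matrix.l2_opNorm_diagonal]
    refine (pi_norm_le_iff_of_nonneg (inv_nonneg.2 hσ.le)).2 fun j => ?_
    rw [norm_inv, Complex.norm_real, Real.norm_of_nonneg (hσ.le.trans (hσe j))]
    exact inv_anti₀ hσ (hσe j)
  have hcpos : 0 < ‖c‖ := norm_pos_iff.2 hc
  have hUn : ‖U'ᴴ‖ ≤ 1 := by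
    rw [Matrix.l2_opNorm_conjTranspose]; exact l2_opNorm_le_one_of_isometry hUU
  have hbound : ‖c‖ ≤ (σ i)⁻¹ * (1 * (‖A - X * Y‖ * (1 * ‖c‖))) := by
    calc ‖c‖ = ‖Matrix.diagonal (fun j => (σ (emb j) : ℂ)⁻¹) *
          (U'ᴴ * ((A - X * Y) * (V' * c)))‖ := by rw [← hceq]
      _ ≤ _ := by
        refine (Matrix.l2_opNorm_mul _ _).trans (mul_le_mul hd ?_ (norm_nonneg _)
          (inv_nonneg.2 hσ.le))
        refine (Matrix.l2_opNorm_mul _ _).trans (mul_le_mul hUn ?_ (norm_nonneg _) zero_le_one)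
        refine (Matrix.l2_opNorm_mul _ _).trans (mul_le_mul_of_nonneg_left ?_ (norm_nonneg _))
        exact (Matrix.l2_opNorm_mul _ _).trans (mul_le_mul_of_nonneg_right
          (l2_opNorm_le_one_of_isometry hVV) (norm_nonneg _))
  have h5 : ‖c‖ ≤ ((σ i)⁻¹ * ‖A - X * Y‖) * ‖c‖ := by linarith
  have h6 : 1 ≤ (σ i)⁻¹ * ‖A - X * Y‖ := by
    by_contra hlt
    push Not at hlt
    nlinarith
  rwa [inv_mul_eq_div, one_le_div hσ] at h6

theorem IsLeadingLeft.exists_truncation [DecidableEq n] {L : ℕ} {A : Matrix m n ℂ}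
    {Us : Matrix m (Fin L) ℂ} (h : IsLeadingLeft A Us) :
    ∃ (S : Matrix (Fin L) n ℂ) (R : Matrix m n ℂ), A = Us * S + R ∧ R * Aᴴ = R * Rᴴ ∧
      ∀ (X : Matrix m (Fin L) ℂ) (Y : Matrix (Fin L) n ℂ), ‖R‖ ≤ ‖A - X * Y‖ := by
  classical
  obtain ⟨r, hr, U, σ, V, hs, rfl⟩ := h
  -- The discarded tail of the singular values; `R * Aᴴ = R * Rᴴ` reduces to `τ σ = τ²`.
  let τ : Fin r → ℂ := fun i => if L ≤ (i : ℕ) then (σ i : ℂ) else 0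
  have hτ : ∀ i, τ i * star (σ i : ℂ) = τ i * star (τ i) := by
    intro i
    by_cases hi : L ≤ (i : ℕ) <;> simp [τ, hi]
  have hmul : ∀ a : Fin r → ℂ, (U * Matrix.diagonal τ * Vᴴ) * (U * Matrix.diagonal a * Vᴴ)ᴴ =
      U * Matrix.diagonal (fun i => τ i * star (a i)) * Uᴴ := by
    intro a
    calc _ = U * Matrix.diagonal τ * (Vᴴ * V) * (Matrix.diagonal a)ᴴ * Uᴴ := by
          simp only [Matrix.conjTranspose_mul, Matrix.conjTranspose_conjTranspose, Matrix.mul_assoc]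
      _ = _ := by
          rw [hs.orthonormal_right, Matrix.mul_one, Matrix.diagonal_conjTranspose,
            Matrix.mul_assoc U, Matrix.diagonal_mul_diagonal]
          rfl
  refine ⟨(Matrix.diagonal (fun i => (σ i : ℂ)) * Vᴴ).submatrix (Fin.castLE hr) id,
    U * Matrix.diagonal τ * Vᴴ, ?_, ?_, fun X Y => ?_⟩
  · have h1 : U.submatrix id (Fin.castLE hr) *
        (Matrix.diagonal (fun i => (σ i : ℂ)) * Vᴴ).submatrix (Fin.castLE hr) id =
        U * Matrix.diagonal (fun i => (σ i : ℂ) - τ i) * Vᴴ := by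
      ext a b
      rw [Matrix.mul_assoc, Matrix.mul_apply, Matrix.mul_apply]
      simp only [Matrix.submatrix_apply, id, Matrix.diagonal_mul]
      rw [← Finset.sum_subset (Finset.subset_univ (Finset.univ.image (Fin.castLE hr))),
        Finset.sum_image fun _ _ _ _ h => Fin.castLE_injective hr h]
      · refine Finset.sum_congr rfl fun i _ => ?_
        have : ¬ L ≤ (i : ℕ) := not_le.2 i.2
        simp [τ, this]
      · intro i _ hi
        have : L ≤ (i : ℕ) := by
          by_contra hlt
          exact hi (Finset.mem_image.2 ⟨⟨i, not_le.1 hlt⟩, Finset.mem_univ _, rfl⟩)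
        simp [τ, this]
    rw [h1, ← Matrix.add_mul, ← Matrix.mul_add, Matrix.diagonal_add]
    simp only [sub_add_cancel]
    exact hs.eq
  · conv_lhs => rw [hs.eq]
    rw [hmul, hmul]
    simp only [hτ]
  · have hn := norm_nonneg (A - X * Y)
    have hτn : ‖(Matrix.diagonal τ : Matrix (Fin r) (Fin r) ℂ)‖ ≤ ‖A - X * Y‖ := by
      rw [Matrix.l2_opNorm_diagonal]
      refine (pi_norm_le_iff_of_nonneg hn).2 fun i => ?_
      by_cases hi : L ≤ (i : ℕ)
      · simpa [τ, hi, abs_of_nonneg (hs.nonneg i)] using hs.singularValue_le X Y i hi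
      · simp [τ, hi]
    have hV : ‖Vᴴ‖ ≤ 1 := by
      rw [Matrix.l2_opNorm_conjTranspose]; exact l2_opNorm_le_one_of_isometry hs.orthonormal_right
    calc ‖U * Matrix.diagonal τ * Vᴴ‖ ≤ ‖U * Matrix.diagonal τ‖ * ‖Vᴴ‖ := Matrix.l2_opNorm_mul _ _
      _ ≤ (‖U‖ * ‖(Matrix.diagonal τ : Matrix (Fin r) (Fin r) ℂ)‖) * ‖Vᴴ‖ := by
          gcongr; exact Matrix.l2_opNorm_mul _ _
      _ ≤ (1 * ‖A - X * Y‖) * 1 := by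
          gcongr; exact l2_opNorm_le_one_of_isometry hs.orthonormal_left
      _ = _ := by ring

end SVD

/-! ### Eigenvalues and eigenvectors near a diagonal matrix with distinct entries. -/

section Eigen

open scoped Matrix.Norms.L2Operator

theorem pow_card_le_norm_prod_sub (s : Multiset ℂ) (x : ℂ) {δ : ℝ} (hδ : 0 ≤ δ)
    (h : ∀ z ∈ s, δ ≤ ‖x - z‖) : δ ^ Multiset.card s ≤ ‖(s.map fun z => x - z).prod‖ := by
  induction s using Multiset.induction_on with
  | empty => simp
  | cons a s ih =>
    rw [Multiset.card_cons, pow_succ', Multiset.map_cons, Multiset.prod_cons, norm_mul]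
    exact mul_le_mul (h a (Multiset.mem_cons_self a s))
      (ih fun z hz => h z (Multiset.mem_cons_of_mem hz)) (pow_nonneg hδ _) (norm_nonneg _)

variable {L : ℕ}

/-- If all `L` roots were at distance at least `δ` from `x`, the factored monic polynomial would
have modulus at least `δ ^ L` there. -/
theorem exists_root_charpoly_near (K : Matrix (Fin L) (Fin L) ℂ) (x : ℂ) {δ : ℝ} (hδ : 0 ≤ δ)
    (h : ‖K.charpoly.eval x‖ < δ ^ L) : ∃ z ∈ K.charpoly.roots, ‖x - z‖ < δ := by
  by_contra! hne
  have hs := IsAlgClosed.splits K.charpoly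
  have h1 := pow_card_le_norm_prod_sub K.charpoly.roots x hδ hne
  rw [← hs.eval_eq_prod_roots_of_monic K.charpoly_monic,
    ← hs.natDegree_eq_card_roots, K.charpoly_natDegree_eq_dim, Fintype.card_fin] at h1
  exact absurd h (not_lt.2 h1)

theorem eventually_root_charpoly_near (μ : Fin L → ℂ) {δ : ℝ} (hδ : 0 < δ) :
    ∀ᶠ X in 𝓝 (0 : Matrix (Fin L) (Fin L) ℂ), ∀ l,
      ∃ z ∈ (Matrix.diagonal μ + X).charpoly.roots, ‖μ l - z‖ < δ := by
  refine Filter.eventually_all.2 fun l => ?_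
  have hc : Continuous fun X : Matrix (Fin L) (Fin L) ℂ =>
      ‖(Matrix.scalar (Fin L) (μ l) - (Matrix.diagonal μ + X)).det‖ :=
    (Continuous.matrix_det (by fun_prop)).norm
  have h0 : ‖(Matrix.scalar (Fin L) (μ l) - (Matrix.diagonal μ + 0)).det‖ = 0 := by
    rw [norm_eq_zero, add_zero, Matrix.scalar_apply, Matrix.diagonal_sub, Matrix.det_diagonal]
    exact Finset.prod_eq_zero (Finset.mem_univ l) (sub_self _)
  have hev := (hc.tendsto 0).eventually
    (gt_mem_nhds (show ‖(Matrix.scalar (Fin L) (μ l) - (Matrix.diagonal μ + 0)).det‖ < δ ^ L by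
      rw [h0]; positivity))
  filter_upwards [hev] with X hX
  exact exists_root_charpoly_near _ _ hδ.le (by rwa [Matrix.eval_charpoly])

theorem exists_separation {μ : Fin L → ℂ} (hμ : Function.Injective μ) :
    ∃ δ : ℝ, 0 < δ ∧ ∀ i j, i ≠ j → 2 * δ ≤ ‖μ i - μ j‖ := by
  have h : ∀ i j, ∃ δ : ℝ, 0 < δ ∧ (i ≠ j → 2 * δ ≤ ‖μ i - μ j‖) := by
    intro i j
    rcases eq_or_ne i j with rfl | hij
    · exact ⟨1, one_pos, fun h => absurd rfl h⟩
    · have : 0 < ‖μ i - μ j‖ := norm_pos_iff.2 (sub_ne_zero.2 (hμ.ne hij))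
      exact ⟨‖μ i - μ j‖ / 2, by positivity, fun _ => by linarith⟩
  choose f hf hf' using h
  rcases isEmpty_or_nonempty (Fin L) with hL | hL
  · exact ⟨1, one_pos, fun i => isEmptyElim i⟩
  obtain ⟨p, hp⟩ := Finite.exists_min fun p : Fin L × Fin L => f p.1 p.2
  exact ⟨f p.1 p.2, hf _ _, fun i j hij => le_trans (by have := hp (i, j); simp at this; linarith)
    (hf' i j hij)⟩

theorem injective_of_near {μ z : Fin L → ℂ} {δ : ℝ}
    (hsep : ∀ i j, i ≠ j → 2 * δ ≤ ‖μ i - μ j‖) (hz : ∀ l, ‖μ l - z l‖ < δ) :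
    Function.Injective z := by
  intro i j hij
  by_contra hne
  have h1 := hsep i j hne
  have h2 : ‖μ i - μ j‖ ≤ ‖μ i - z i‖ + ‖μ j - z j‖ := by
    have : μ i - μ j = (μ i - z i) - (μ j - z j) := by rw [hij]; ring
    rw [this]; exact norm_sub_le _ _
  have := hz i
  have := hz j
  linarith

theorem exists_diagonalization_of_injective_roots {K : Matrix (Fin L) (Fin L) ℂ} {z : Fin L → ℂ}
    (hz : Function.Injective z) (hr : ∀ l, z l ∈ K.charpoly.roots) :
    ∃ E : Matrix (Fin L) (Fin L) ℂ, IsUnit E ∧ K = E * Matrix.diagonal z * E⁻¹ := by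
  have hv : ∀ l, ∃ v : Fin L → ℂ, v ≠ 0 ∧ K *ᵥ v = z l • v := by
    intro l
    have h1 := (Polynomial.mem_roots'.1 (hr l)).2
    rw [Polynomial.IsRoot, Matrix.eval_charpoly, ← Matrix.exists_mulVec_eq_zero_iff] at h1
    obtain ⟨v, hv0, hv⟩ := h1
    refine ⟨v, hv0, ?_⟩
    rw [Matrix.sub_mulVec, sub_eq_zero] at hv
    rw [← hv]
    funext i
    simp [Matrix.scalar_apply, Matrix.mulVec_diagonal]
  choose v hv0 hv using hv
  have hli : LinearIndependent ℂ v := Module.End.eigenvectors_linearIndependent' K.mulVecLin z hz v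
    fun l => Module.End.hasEigenvector_iff.2 ⟨Module.End.mem_eigenspace_iff.2 (hv l), hv0 l⟩
  let E : Matrix (Fin L) (Fin L) ℂ := Matrix.of fun i l => v l i
  have hE : IsUnit E := Matrix.linearIndependent_cols_iff_isUnit.1 hli
  refine ⟨E, hE, ?_⟩
  have hKE : K * E = E * Matrix.diagonal z := by
    ext i l
    rw [Matrix.mul_diagonal]
    have := congrFun (hv l) i
    rw [Pi.smul_apply, smul_eq_mul, mul_comm] at this
    exact this
  rw [← hKE, Matrix.mul_assoc, Matrix.mul_nonsing_inv _ ((Matrix.isUnit_iff_isUnit_det _).1 hE),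
    Matrix.mul_one]

theorem eventually_exists_diagonalization {μ : Fin L → ℂ} (hμ : Function.Injective μ) :
    ∀ᶠ X in 𝓝 (0 : Matrix (Fin L) (Fin L) ℂ), ∃ (E : Matrix (Fin L) (Fin L) ℂ) (d : Fin L → ℂ),
      IsUnit E ∧ Matrix.diagonal μ + X = E * Matrix.diagonal d * E⁻¹ := by
  obtain ⟨δ, hδ, hsep⟩ := exists_separation hμ
  filter_upwards [eventually_root_charpoly_near μ hδ] with X hX
  choose z hzr hz using hX
  obtain ⟨E, hE⟩ := exists_diagonalization_of_injective_roots (injective_of_near hsep hz) hzr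
  exact ⟨E, z, hE⟩

theorem exists_norm_le_entries (m n : Type*) [Fintype m] [Fintype n] [DecidableEq n] :
    ∃ C : ℝ, 0 ≤ C ∧ ∀ (X : Matrix m n ℂ) (r : ℝ), 0 ≤ r → (∀ i j, ‖X i j‖ ≤ r) →
      ‖X‖ ≤ C * r := by
  -- The identity map, from the sup norm to the operator norm; finite dimension makes it bounded.
  let f : (m → n → ℂ) →ₗ[ℂ] Matrix m n ℂ := (Matrix.ofLinearEquiv ℂ).toLinearMap
  refine ⟨‖LinearMap.toContinuousLinearMap f‖, ContinuousLinearMap.opNorm_nonneg _, fun X r hr h => ?_⟩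
  refine ((LinearMap.toContinuousLinearMap f).le_opNorm X).trans ?_
  refine mul_le_mul_of_nonneg_left ?_ (ContinuousLinearMap.opNorm_nonneg _)
  exact (pi_norm_le_iff_of_nonneg hr).2 fun i => (pi_norm_le_iff_of_nonneg hr).2 fun j => h i j

theorem norm_entry_le_l2_opNorm {m n : Type*} [Fintype m] [Fintype n] [DecidableEq n]
    (X : Matrix m n ℂ) (i : m) (j : n) : ‖X i j‖ ≤ ‖X‖ := by
  have h1 := Matrix.l2_opNorm_mulVec X (EuclideanSpace.single j 1)
  rw [PiLp.norm_single, norm_one, mul_one] at h1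
  refine le_trans ?_ h1
  refine le_trans (le_of_eq ?_) (PiLp.norm_apply_le _ i)
  simp

theorem norm_mulVec_apply_le (X : Matrix (Fin L) (Fin L) ℂ) (v : Fin L → ℂ) (i : Fin L) {r : ℝ}
    (hv : ∀ j, ‖v j‖ ≤ r) : ‖(X *ᵥ v) i‖ ≤ L * ‖X‖ * r := by
  calc ‖(X *ᵥ v) i‖ ≤ ∑ j, ‖X i j * v j‖ := by
        rw [Matrix.mulVec, dotProduct]; exact norm_sum_le _ _
    _ ≤ ∑ _j : Fin L, ‖X‖ * r := by
      refine Finset.sum_le_sum fun j _ => ?_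
      rw [norm_mul]
      exact mul_le_mul (norm_entry_le_l2_opNorm X i j) (hv j) (norm_nonneg _) (norm_nonneg _)
    _ = L * ‖X‖ * r := by simp [mul_assoc]

/-- Row `j ≠ l` of the eigenvalue equation reads `(z - μ j) v j = (X v) j` with `‖z - μ j‖ ≥ δ`, so
`v j` is small relative to the largest entry, which must therefore be `v l`. -/
theorem eigenvector_near {μ : Fin L → ℂ} {δ : ℝ} (hδ : 0 < δ)
    (hsep : ∀ i j, i ≠ j → 2 * δ ≤ ‖μ i - μ j‖) {X : Matrix (Fin L) (Fin L) ℂ}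
    (hX : L * ‖X‖ < δ) {v : Fin L → ℂ} (hv0 : v ≠ 0) {z : ℂ} {l : Fin L} (hz : ‖μ l - z‖ < δ)
    (hv : (Matrix.diagonal μ + X) *ᵥ v = z • v) :
    v l ≠ 0 ∧ ∀ j, j ≠ l → ‖v j‖ ≤ L * ‖X‖ / δ * ‖v l‖ := by
  have : Nonempty (Fin L) := ⟨l⟩
  obtain ⟨i₀, hi₀⟩ := Finite.exists_max fun j => ‖v j‖
  have hpos : 0 < ‖v i₀‖ := by
    obtain ⟨j, hj⟩ := Function.ne_iff.1 hv0
    exact (norm_pos_iff.2 hj).trans_le (hi₀ j)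
  have key : ∀ j, j ≠ l → ‖v j‖ ≤ L * ‖X‖ / δ * ‖v i₀‖ := by
    intro j hj
    have h1 : (z - μ j) * v j = (X *ᵥ v) j := by
      have := congrFun hv j
      rw [Matrix.add_mulVec, Pi.add_apply, Matrix.mulVec_diagonal, Pi.smul_apply,
        smul_eq_mul] at this
      linear_combination -this
    have h2 : δ ≤ ‖z - μ j‖ := by
      have h3 := hsep l j hj.symm
      have h4 : ‖μ l - μ j‖ ≤ ‖μ l - z‖ + ‖z - μ j‖ := by
        simpa using norm_add_le (μ l - z) (z - μ j)
      linarith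
    have h5 : ‖z - μ j‖ * ‖v j‖ ≤ L * ‖X‖ * ‖v i₀‖ := by
      rw [← norm_mul, h1]
      exact norm_mulVec_apply_le X v j hi₀
    rw [div_mul_eq_mul_div, le_div_iff₀ hδ]
    nlinarith [norm_nonneg (v j)]
  have hl : i₀ = l := by
    by_contra hne
    have h1 := key i₀ hne
    have h2 : L * ‖X‖ / δ < 1 := (div_lt_one hδ).2 hX
    nlinarith
  subst hl
  exact ⟨norm_pos_iff.1 hpos, key⟩

/-- The difference `Z A (1 + X) - A` equals `Z [A, X]` with `Z = 1 - Z X`. The only term of first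
order in `X` alone is `[D, X]`, whose diagonal is zero. -/
theorem norm_conj_diag_sub_le {X Z A N : Matrix (Fin L) (Fin L) ℂ} {φ : Fin L → ℂ}
    (hZ : Z * (1 + X) = 1) (hX : ‖X‖ ≤ 1 / 2) (hA : A = Matrix.diagonal φ + N) (l : Fin L) :
    ‖(Z * A * (1 + X)) l l - A l l‖ ≤
      4 * ‖X‖ * (‖X‖ * ‖(Matrix.diagonal φ : Matrix (Fin L) (Fin L) ℂ)‖ + ‖N‖) := by
  have hone : ‖(1 : Matrix (Fin L) (Fin L) ℂ)‖ ≤ 1 :=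
    l2_opNorm_le_one_of_isometry (by simp)
  set D : Matrix (Fin L) (Fin L) ℂ := Matrix.diagonal φ with hD
  have hZn : ‖Z‖ ≤ 2 := by
    have h1 : Z = 1 - Z * X := by rw [← hZ]; noncomm_ring
    have h2 : ‖Z‖ ≤ 1 + ‖Z‖ * ‖X‖ := by
      calc ‖Z‖ = ‖1 - Z * X‖ := by rw [← h1]
        _ ≤ ‖(1 : Matrix (Fin L) (Fin L) ℂ)‖ + ‖Z * X‖ := norm_sub_le _ _
        _ ≤ _ := add_le_add hone (norm_mul_le _ _)
    nlinarith [norm_nonneg Z]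
  have hmul : Z * A * (1 + X) - A = (D * X - X * D) + ((N * X - X * N) -
      Z * X * ((D * X - X * D) + (N * X - X * N))) := by
    have h1 : Z = 1 - Z * X := by rw [← hZ]; noncomm_ring
    have h2 : Z * A * (1 + X) - A = Z * (A * X - X * A) := by
      calc _ = Z * A * (1 + X) - Z * (1 + X) * A := by rw [hZ, one_mul]
        _ = _ := by noncomm_ring
    rw [h2, hA]
    nth_rewrite 1 [h1]
    noncomm_ring
  have hcomm : (D * X - X * D) l l = 0 := by
    rw [hD, Matrix.sub_apply, Matrix.diagonal_mul, Matrix.mul_diagonal]; ring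
  have hent : (Z * A * (1 + X)) l l - A l l = ((N * X - X * N) -
      Z * X * ((D * X - X * D) + (N * X - X * N))) l l := by
    rw [← Matrix.sub_apply, hmul, Matrix.add_apply, hcomm, zero_add]
  rw [hent]
  refine (norm_entry_le_l2_opNorm _ l l).trans ?_
  have c1 : ‖N * X - X * N‖ ≤ 2 * (‖N‖ * ‖X‖) := by
    refine (norm_sub_le _ _).trans ?_
    have := norm_mul_le N X
    have := norm_mul_le X N
    linarith
  have c2 : ‖D * X - X * D‖ ≤ 2 * (‖D‖ * ‖X‖) := by
    refine (norm_sub_le _ _).trans ?_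
    have := norm_mul_le D X
    have := norm_mul_le X D
    linarith
  have c3 : ‖Z * X * ((D * X - X * D) + (N * X - X * N))‖ ≤
      2 * ‖X‖ * (2 * (‖D‖ * ‖X‖) + 2 * (‖N‖ * ‖X‖)) := by
    refine (norm_mul_le _ _).trans (mul_le_mul ?_ ((norm_add_le _ _).trans (add_le_add c2 c1))
      (norm_nonneg _) (by positivity))
    exact (norm_mul_le _ _).trans (mul_le_mul_of_nonneg_right hZn (norm_nonneg _))
  have c4 : ‖X‖ * (‖N‖ * ‖X‖) ≤ 1 / 2 * (‖N‖ * ‖X‖) :=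
    mul_le_mul_of_nonneg_right hX (by positivity)
  refine (norm_sub_le _ _).trans ((add_le_add c1 c3).trans ?_)
  nlinarith

/-- First-order perturbation of the diagonal of a matrix in the eigenbasis of a perturbed diagonal
matrix with distinct entries. -/
theorem eventually_diag_conj_near {μ : Fin L → ℂ} (hμ : Function.Injective μ) :
    ∃ C : ℝ, 0 ≤ C ∧ ∀ᶠ X in 𝓝 (0 : Matrix (Fin L) (Fin L) ℂ),
      ∀ (E : Matrix (Fin L) (Fin L) ℂ) (d : Fin L → ℂ), IsUnit E →
        Matrix.diagonal μ + X = E * Matrix.diagonal d * E⁻¹ →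
        ∃ σ : Equiv.Perm (Fin L), ∀ (φ : Fin L → ℂ) (N : Matrix (Fin L) (Fin L) ℂ) (l : Fin L),
          ‖(E⁻¹ * (Matrix.diagonal φ + N) * E) (σ l) (σ l) - φ l - N l l‖ ≤
            C * ‖X‖ * (‖X‖ * ‖(Matrix.diagonal φ : Matrix (Fin L) (Fin L) ℂ)‖ + ‖N‖) := by
  obtain ⟨δ, hδ, hsep⟩ := exists_separation hμ
  obtain ⟨C₀, hC₀, hentries⟩ := exists_norm_le_entries (Fin L) (Fin L)
  set C₁ : ℝ := C₀ * (L / δ) with hC₁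
  have hC₁0 : 0 ≤ C₁ := by positivity
  have hsmall : ∀ c r : ℝ, 0 < r → ∀ᶠ X in 𝓝 (0 : Matrix (Fin L) (Fin L) ℂ), c * ‖X‖ < r := by
    intro c r hr
    have : Filter.Tendsto (fun X : Matrix (Fin L) (Fin L) ℂ => c * ‖X‖) (𝓝 0) (𝓝 0) := by
      have h : Continuous fun X : Matrix (Fin L) (Fin L) ℂ => c * ‖X‖ := by fun_prop
      simpa using h.tendsto 0
    exact this.eventually (gt_mem_nhds hr)
  refine ⟨4 * C₁ * (C₁ + 1), by positivity, ?_⟩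
  filter_upwards [eventually_root_charpoly_near μ hδ, hsmall L δ hδ, hsmall C₁ (1 / 2) (by norm_num)]
    with X hroot hX1 hX2 E d hE hdiag
  have hdet := (Matrix.isUnit_iff_isUnit_det _).1 hE
  have hEE : E * E⁻¹ = 1 := Matrix.mul_nonsing_inv _ hdet
  have hEE' : E⁻¹ * E = 1 := Matrix.nonsing_inv_mul _ hdet
  have hchar : (Matrix.diagonal μ + X).charpoly = ∏ i, (Polynomial.X - Polynomial.C (d i)) := by
    rw [hdiag, Matrix.charpoly_mul_comm, ← Matrix.mul_assoc, hEE', Matrix.one_mul,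
      Matrix.charpoly_diagonal]
  have hex : ∀ l, ∃ i, ‖μ l - d i‖ < δ := by
    intro l
    obtain ⟨z, hz, hzl⟩ := hroot l
    rw [hchar] at hz
    have hz' := (Polynomial.mem_roots'.1 hz).2
    rw [Polynomial.IsRoot, Polynomial.eval_prod, Finset.prod_eq_zero_iff] at hz'
    obtain ⟨i, -, hi⟩ := hz'
    rw [Polynomial.eval_sub, Polynomial.eval_X, Polynomial.eval_C, sub_eq_zero] at hi
    exact ⟨i, hi ▸ hzl⟩
  choose s hs using hex
  have hsinj : Function.Injective s :=
    -- The discs of radius `δ` around the `μ l` are disjoint, so matching each `μ l` to a nearby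
    -- eigenvalue is injective, hence a permutation.
    Function.Injective.of_comp (f := d) (injective_of_near hsep hs)
  let σ : Equiv.Perm (Fin L) := Equiv.ofBijective s (Finite.injective_iff_bijective.1 hsinj)
  have hKE : (Matrix.diagonal μ + X) * E = E * Matrix.diagonal d := by
    rw [hdiag, Matrix.mul_assoc, hEE', Matrix.mul_one]
  have hev : ∀ l, E l (σ l) ≠ 0 ∧ ∀ j, j ≠ l → ‖E j (σ l)‖ ≤ L * ‖X‖ / δ * ‖E l (σ l)‖ := by
    intro l
    refine eigenvector_near (v := fun j => E j (σ l)) hδ hsep hX1 ?_ (hs l) ?_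
    · intro h0
      have h1 := congrFun (congrFun hEE' (σ l)) (σ l)
      rw [Matrix.mul_apply, Matrix.one_apply_eq] at h1
      refine zero_ne_one (Eq.trans ?_ h1)
      refine (Finset.sum_eq_zero fun j _ => ?_).symm
      rw [show E j (σ l) = 0 from congrFun h0 j, mul_zero]
    · funext j
      have h1 := congrFun (congrFun hKE j) (σ l)
      rw [Matrix.mul_diagonal, mul_comm] at h1
      exact h1
  let c : Fin L → ℂ := fun l => E l (σ l)
  have hc : ∀ l, c l ≠ 0 := fun l => (hev l).1
  -- Reordering the eigenvectors and scaling each to have entry `1` at `l` turns `E` into `1 + Y`;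
  -- neither operation alters the conjugated diagonal beyond relabelling it.
  let Y : Matrix (Fin L) (Fin L) ℂ := Matrix.of fun j l => if j = l then 0 else E j (σ l) / c l
  have hY : ‖Y‖ ≤ C₁ * ‖X‖ := by
    have : ‖Y‖ ≤ C₀ * (L * ‖X‖ / δ) := by
      refine hentries Y _ (by positivity) fun j l => ?_
      by_cases hjl : j = l
      · simp only [Y, Matrix.of_apply, hjl, if_true, norm_zero]; positivity
      · simp only [Y, Matrix.of_apply, hjl, if_false, norm_div]
        rw [div_le_iff₀ (norm_pos_iff.2 (hc l))]
        exact (hev l).2 j hjl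
    calc ‖Y‖ ≤ _ := this
      _ = C₁ * ‖X‖ := by rw [hC₁]; ring
  have hEσ : E.submatrix id σ = (1 + Y) * Matrix.diagonal c := by
    ext j l
    rw [Matrix.mul_diagonal, Matrix.add_apply]
    by_cases hjl : j = l
    · subst hjl; simp [Y, c]
    · simp [Y, hjl, hc l]
  let Z : Matrix (Fin L) (Fin L) ℂ := Matrix.diagonal c * E⁻¹.submatrix σ id
  have hEσ' : 1 + Y = E.submatrix id σ * Matrix.diagonal (fun l => (c l)⁻¹) := by
    rw [hEσ, Matrix.mul_assoc, Matrix.diagonal_mul_diagonal]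
    simp [hc]
  have hZ : Z * (1 + Y) = 1 := by
    have h1 : E⁻¹.submatrix σ id * E.submatrix id σ = 1 := by
      rw [← Matrix.submatrix_mul _ _ _ _ _ Function.bijective_id, hEE',
        Matrix.submatrix_one _ σ.injective]
    rw [hEσ', Matrix.mul_assoc, ← Matrix.mul_assoc (E⁻¹.submatrix σ id), h1, Matrix.one_mul,
      Matrix.diagonal_mul_diagonal]
    simp [hc]
  -- The permutation is fixed before `φ` and `N`, so it can serve all modes at once.
  refine ⟨σ, fun φ N l => ?_⟩
  have hentry : (E⁻¹ * (Matrix.diagonal φ + N) * E) (σ l) (σ l) =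
      (Z * (Matrix.diagonal φ + N) * (1 + Y)) l l := by
    have h1 : Z * (Matrix.diagonal φ + N) * (1 + Y) = Matrix.diagonal c *
        (E⁻¹ * (Matrix.diagonal φ + N) * E).submatrix σ σ * Matrix.diagonal (fun l => (c l)⁻¹) := by
      rw [hEσ', ← Matrix.submatrix_mul_equiv _ _ _ (Equiv.refl _) _,
        ← Matrix.submatrix_mul_equiv _ _ _ (Equiv.refl _) _]
      simp only [Z, Matrix.mul_assoc, Equiv.coe_refl, Matrix.submatrix_id_id]
    rw [h1, Matrix.mul_diagonal, Matrix.diagonal_mul, Matrix.submatrix_apply]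
    field_simp [hc l]
  have hYhalf : ‖Y‖ ≤ 1 / 2 := hY.trans hX2.le
  have hfin := norm_conj_diag_sub_le hZ hYhalf (rfl : Matrix.diagonal φ + N = _) l
  rw [hentry, sub_sub]
  rw [Matrix.add_apply, Matrix.diagonal_apply_eq] at hfin
  refine hfin.trans ?_
  have hp := norm_nonneg (Matrix.diagonal φ : Matrix (Fin L) (Fin L) ℂ)
  calc 4 * ‖Y‖ * (‖Y‖ * ‖(Matrix.diagonal φ : Matrix (Fin L) (Fin L) ℂ)‖ + ‖N‖)
      ≤ 4 * (C₁ * ‖X‖) * ((C₁ + 1) *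
        (‖X‖ * ‖(Matrix.diagonal φ : Matrix (Fin L) (Fin L) ℂ)‖ + ‖N‖)) := by
        gcongr
        have h1 : ‖Y‖ * ‖(Matrix.diagonal φ : Matrix (Fin L) (Fin L) ℂ)‖ ≤
            C₁ * ‖X‖ * ‖(Matrix.diagonal φ : Matrix (Fin L) (Fin L) ℂ)‖ := by gcongr
        have h2 : 0 ≤ ‖X‖ * ‖(Matrix.diagonal φ : Matrix (Fin L) (Fin L) ℂ)‖ := by positivity
        have h3 : 0 ≤ C₁ * ‖N‖ := by positivity
        nlinarith
    _ = _ := by ring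

end Eigen

/-! ### Continuity of the pseudoinverse at full column rank, and semicontinuity of rank. -/

section Continuity

variable {L : ℕ} {m n r : Type*} [Fintype m] [Fintype n] [Fintype r]

theorem eventually_isUnit_conjTranspose_mul_self {J : Matrix r m ℂ} {P : Matrix m (Fin L) ℂ}
    (h : IsUnit ((J * P)ᴴ * (J * P))) :
    ∀ᶠ X in 𝓝 P, IsUnit ((J * X)ᴴ * (J * X)) := by
  have hc : Continuous fun X : Matrix m (Fin L) ℂ => ((J * X)ᴴ * (J * X)).det :=
    Continuous.matrix_det (by fun_prop)
  have h0 : ((J * P)ᴴ * (J * P)).det ≠ 0 := ((Matrix.isUnit_iff_isUnit_det _).1 h).ne_zero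
  filter_upwards [(hc.tendsto P).eventually (isOpen_ne.mem_nhds h0)] with X hX
  exact (Matrix.isUnit_iff_isUnit_det _).2 (isUnit_iff_ne_zero.2 hX)

theorem continuousAt_matrix_mul {α l k : Type*} [TopologicalSpace α] {f : α → Matrix l m ℂ}
    {g : α → Matrix m k ℂ} {x : α} (hf : ContinuousAt f x) (hg : ContinuousAt g x) :
    ContinuousAt (fun x => f x * g x) x := by
  have hmul : Continuous fun p : Matrix l m ℂ × Matrix m k ℂ => p.1 * p.2 :=
    Continuous.matrix_mul continuous_fst continuous_snd
  exact hmul.continuousAt.comp (f := fun x => (f x, g x)) (hf.prodMk hg)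

/-- The pseudoinverse is discontinuous where the rank drops; near a full column rank point it is the
continuous expression `(Aᴴ A)⁻¹ Aᴴ`. -/
theorem continuousAt_pinv_mul {J : Matrix r m ℂ} {P : Matrix m (Fin L) ℂ}
    (h : IsUnit ((J * P)ᴴ * (J * P))) :
    ContinuousAt (fun X : Matrix m (Fin L) ℂ => pinv (J * X)) P := by
  have hc : Continuous fun X : Matrix m (Fin L) ℂ => (J * X)ᴴ * (J * X) := by fun_prop
  have hc' : Continuous fun X : Matrix m (Fin L) ℂ => (J * X)ᴴ := by fun_prop
  have h0 : ((J * P)ᴴ * (J * P)).det ≠ 0 := ((Matrix.isUnit_iff_isUnit_det _).1 h).ne_zero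
  have hinv : ContinuousAt (fun X : Matrix m (Fin L) ℂ => ((J * X)ᴴ * (J * X))⁻¹) P := by
    simp only [Matrix.inv_def, Ring.inverse_eq_inv']
    exact ((Continuous.matrix_det hc).continuousAt.inv₀ h0).smul
      (Continuous.matrix_adjugate hc).continuousAt
  refine (continuousAt_matrix_mul hinv hc'.continuousAt).congr ?_
  filter_upwards [eventually_isUnit_conjTranspose_mul_self h] with X hX
  exact (pinv_eq_of_isUnit hX).symm

theorem pinv_mul_self_of_isUnit {A : Matrix r (Fin L) ℂ} (h : IsUnit (Aᴴ * A)) :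
    pinv A * A = 1 := by
  rw [pinv_eq_of_isUnit h, Matrix.mul_assoc,
    Matrix.nonsing_inv_mul _ ((Matrix.isUnit_iff_isUnit_det _).1 h)]

/-- The error matrix of the least-squares solution `(J₁ X)† (J₂ X)`, linear in `X - P` up to the
first factor. -/
theorem pinv_mul_eq_add {J₁ J₂ : Matrix r m ℂ} {P : Matrix m (Fin L) ℂ} {φ : Fin L → ℂ}
    (hP : J₂ * P = J₁ * P * Matrix.diagonal φ) {X : Matrix m (Fin L) ℂ}
    (hX : IsUnit ((J₁ * X)ᴴ * (J₁ * X))) :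
    pinv (J₁ * X) * (J₂ * X) = Matrix.diagonal φ +
      pinv (J₁ * X) * (J₂ * (X - P) - J₁ * (X - P) * Matrix.diagonal φ) := by
  have h1 : J₂ * (X - P) - J₁ * (X - P) * Matrix.diagonal φ =
      J₂ * X - J₁ * X * Matrix.diagonal φ := by
    rw [Matrix.mul_sub, Matrix.mul_sub, Matrix.sub_mul, hP]; abel
  rw [h1, Matrix.mul_sub, ← Matrix.mul_assoc (pinv (J₁ * X)) (J₁ * X),
    pinv_mul_self_of_isUnit hX, Matrix.one_mul]
  abel

theorem eventually_le_rank {A₀ : Matrix m n ℂ} {B : Matrix (Fin L) m ℂ} {W : Matrix n (Fin L) ℂ}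
    (h : B * A₀ * W = 1) : ∀ᶠ A in 𝓝 A₀, L ≤ A.rank := by
  have hc : Continuous fun A : Matrix m n ℂ => (B * A * W).det :=
    Continuous.matrix_det (by fun_prop)
  have h0 : (B * A₀ * W).det ≠ 0 := by rw [h, Matrix.det_one]; exact one_ne_zero
  filter_upwards [(hc.tendsto A₀).eventually (isOpen_ne.mem_nhds h0)] with A hA
  have hu : IsUnit (B * A * W) := (Matrix.isUnit_iff_isUnit_det _).2 (isUnit_iff_ne_zero.2 hA)
  calc L = (B * A * W).rank := by rw [Matrix.rank_of_isUnit _ hu, Fintype.card_fin]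
    _ ≤ (B * A).rank := Matrix.rank_mul_le_left _ _
    _ ≤ A.rank := Matrix.rank_mul_le_right _ _

end Continuity

/-! ### First-order expansion of one least-squares solution. -/

section LeastSquares

open scoped Matrix.Norms.L2Operator

variable {L : ℕ} {m r : Type*} [Fintype m] [DecidableEq m] [Fintype r]

theorem norm_mul_sub_mul_diagonal_le (J₁ J₂ : Matrix r m ℂ) (D : Matrix (Fin L) (Fin L) ℂ)
    (X : Matrix m (Fin L) ℂ) : ‖J₂ * X - J₁ * X * D‖ ≤ (‖J₂‖ + ‖J₁‖ * ‖D‖) * ‖X‖ := by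
  have h1 := Matrix.l2_opNorm_mul J₂ X
  have h2 : ‖J₁ * X * D‖ ≤ ‖J₁‖ * ‖X‖ * ‖D‖ := (Matrix.l2_opNorm_mul _ _).trans
    (mul_le_mul_of_nonneg_right (Matrix.l2_opNorm_mul _ _) (norm_nonneg _))
  refine (norm_sub_le _ _).trans ?_
  linarith

theorem exists_pinv_mul_expansion [DecidableEq r] {J₁ J₂ : Matrix r m ℂ} {P : Matrix m (Fin L) ℂ} {φ : Fin L → ℂ}
    (hP : J₂ * P = J₁ * P * Matrix.diagonal φ) (hu : IsUnit ((J₁ * P)ᴴ * (J₁ * P))) :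
    ∃ C : ℝ, 0 ≤ C ∧ ∀ ε : ℝ, 0 < ε → ∀ᶠ X in 𝓝 P, IsUnit ((J₁ * X)ᴴ * (J₁ * X)) ∧
      ∃ R : Matrix (Fin L) (Fin L) ℂ,
        pinv (J₁ * X) * (J₂ * X) = Matrix.diagonal φ + R ∧ ‖R‖ ≤ C * ‖X - P‖ ∧
        ‖R - pinv (J₁ * P) * (J₂ * (X - P) - J₁ * (X - P) * Matrix.diagonal φ)‖ ≤
          ε * ‖X - P‖ := by
  set K : ℝ := ‖J₂‖ + ‖J₁‖ * ‖(Matrix.diagonal φ : Matrix (Fin L) (Fin L) ℂ)‖ with hK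
  have hK0 : 0 ≤ K := by positivity
  have hcont := continuousAt_pinv_mul hu
  refine ⟨(‖pinv (J₁ * P)‖ + 1) * K, by positivity, fun ε hε => ?_⟩
  -- The bound `1` gives a Lipschitz constant independent of `ε`; the other gives the `o(‖X - P‖)`
  -- error, with `K + 1` in case `K = 0`.
  have hδ : 0 < min 1 (ε / (K + 1)) := lt_min one_pos (by positivity)
  filter_upwards [eventually_isUnit_conjTranspose_mul_self hu,
    Metric.continuousAt_iff'.1 hcont _ hδ] with X hX hd
  rw [dist_eq_norm] at hd
  have hd1 := (hd.le.trans (min_le_left _ _))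
  have hd2 := (hd.le.trans (min_le_right _ _))
  have hlin := norm_mul_sub_mul_diagonal_le J₁ J₂ (Matrix.diagonal φ) (X - P)
  refine ⟨hX, _, pinv_mul_eq_add hP hX, ?_, ?_⟩
  · have h1 : ‖pinv (J₁ * X)‖ ≤ ‖pinv (J₁ * P)‖ + 1 := by
      have := norm_add_le (pinv (J₁ * P)) (pinv (J₁ * X) - pinv (J₁ * P))
      rw [add_sub_cancel] at this
      linarith
    refine (Matrix.l2_opNorm_mul _ _).trans ?_
    rw [mul_assoc]
    exact mul_le_mul h1 hlin (norm_nonneg _) (by positivity)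
  · rw [← Matrix.sub_mul]
    refine (Matrix.l2_opNorm_mul _ _).trans ?_
    calc _ ≤ ε / (K + 1) * (K * ‖X - P‖) := mul_le_mul hd2 hlin (norm_nonneg _) (by positivity)
      _ = ε * ‖X - P‖ * (K / (K + 1)) := by ring
      _ ≤ ε * ‖X - P‖ * 1 := by
        gcongr
        rw [div_le_one (by positivity)]
        linarith
      _ = _ := mul_one _

end LeastSquares

/-! ### Simultaneous diagonalization of all modes by the eigenvectors of one combination. -/

section JointDiagonalization

open scoped Matrix.Norms.L2Operator

variable {L : ℕ} {m ι : Type*} {r : ι → Type*} [Fintype m] [DecidableEq m] [Fintype ι]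
  [∀ i, Fintype (r i)] [∀ i, DecidableEq (r i)]

/-- Only the weighted sum needs distinct eigenvalues: its eigenvectors fix one permutation, and each
mode is then read off in that basis, even where its own `φ i` has repetitions. -/
theorem eventually_joint_diagonalization {J₁ J₂ : (i : ι) → Matrix (r i) m ℂ}
    {P : Matrix m (Fin L) ℂ} {φ : ι → Fin L → ℂ} (β : ι → ℂ)
    (hP : ∀ i, J₂ i * P = J₁ i * P * Matrix.diagonal (φ i))
    (hu : ∀ i, IsUnit ((J₁ i * P)ᴴ * (J₁ i * P)))
    (hβ : Function.Injective fun l => ∑ i, β i * φ i l) {ε : ℝ} (hε : 0 < ε) :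
    ∀ᶠ X in 𝓝 P, (∀ i, IsUnit ((J₁ i * X)ᴴ * (J₁ i * X))) ∧
      (∃ (E : Matrix (Fin L) (Fin L) ℂ) (d : Fin L → ℂ), IsUnit E ∧
        ∑ i, β i • (pinv (J₁ i * X) * (J₂ i * X)) = E * Matrix.diagonal d * E⁻¹) ∧
      ∀ (E : Matrix (Fin L) (Fin L) ℂ) (d : Fin L → ℂ), IsUnit E →
        ∑ i, β i • (pinv (J₁ i * X) * (J₂ i * X)) = E * Matrix.diagonal d * E⁻¹ →
        ∃ σ : Equiv.Perm (Fin L), ∀ i l,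
          ‖(E⁻¹ * (pinv (J₁ i * X) * (J₂ i * X)) * E) (σ l) (σ l) - φ i l -
            (pinv (J₁ i * P) * (J₂ i * (X - P) - J₁ i * (X - P) * Matrix.diagonal (φ i))) l l‖ ≤
            ε * ‖X - P‖ := by
  choose C hC hexp using fun i => exists_pinv_mul_expansion (hP i) (hu i)
  obtain ⟨C₀, hC₀, hdiag⟩ := eventually_diag_conj_near hβ
  set B : ℝ := ∑ i, ‖β i‖ * C i with hB
  have hB0 : 0 ≤ B := Finset.sum_nonneg fun i _ => mul_nonneg (norm_nonneg _) (hC i)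
  let c : ι → ℝ := fun i =>
    C₀ * B * (B * ‖(Matrix.diagonal (φ i) : Matrix (Fin L) (Fin L) ℂ)‖ + C i)
  have hc : ∀ i, 0 ≤ c i := fun i => by have := hC i; positivity
  obtain ⟨η, hη, hdiag'⟩ := Metric.eventually_nhds_iff.1
    (hdiag.and (eventually_exists_diagonalization hβ))
  have hX0 : ∀ K : ℝ, ∀ ρ : ℝ, 0 < ρ → ∀ᶠ X in 𝓝 P, K * ‖X - P‖ < ρ := by
    intro K ρ hρ
    have h : Continuous fun X : Matrix m (Fin L) ℂ => K * ‖X - P‖ := by fun_prop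
    have h' := h.tendsto P
    simp only [sub_self, norm_zero, mul_zero] at h'
    exact h'.eventually (gt_mem_nhds hρ)
  filter_upwards [Filter.eventually_all.2 fun i => hexp i (ε / 2) (by positivity), hX0 B η hη,
    Filter.eventually_all.2 fun i => hX0 (c i) (ε / 2) (by positivity)] with X hX hBX hcX
  choose hXu R hR hRn hRe using hX
  have hsum : ∑ i, β i • (pinv (J₁ i * X) * (J₂ i * X)) =
      Matrix.diagonal (fun l => ∑ i, β i * φ i l) + ∑ i, β i • R i := by
    simp only [hR, smul_add, Finset.sum_add_distrib]
    congr 1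
    ext a b
    by_cases hab : a = b
    · subst hab; simp [Matrix.sum_apply]
    · simp [Matrix.sum_apply, hab]
  have hSn : ‖∑ i, β i • R i‖ ≤ B * ‖X - P‖ := by
    refine (norm_sum_le _ _).trans ?_
    rw [hB, Finset.sum_mul]
    refine Finset.sum_le_sum fun i _ => ?_
    rw [norm_smul, mul_assoc]
    exact mul_le_mul_of_nonneg_left (hRn i) (norm_nonneg _)
  obtain ⟨hconj, hexist⟩ := hdiag' (y := ∑ i, β i • R i)
    (by rw [dist_zero_right]; exact hSn.trans_lt hBX)
  refine ⟨hXu, by rwa [hsum], fun E d hE hEd => ?_⟩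
  obtain ⟨σ, hσ⟩ := hconj E d hE (hsum ▸ hEd)
  refine ⟨σ, fun i l => ?_⟩
  have h1 := hσ (φ i) (R i) l
  have h2 := (norm_entry_le_l2_opNorm _ l l).trans (hRe i)
  rw [Matrix.sub_apply] at h2
  have hn := norm_nonneg (X - P)
  have h3 : C₀ * ‖∑ i, β i • R i‖ * (‖∑ i, β i • R i‖ *
      ‖(Matrix.diagonal (φ i) : Matrix (Fin L) (Fin L) ℂ)‖ + ‖R i‖) ≤ ε / 2 * ‖X - P‖ := by
    calc _ ≤ C₀ * (B * ‖X - P‖) * (B * ‖X - P‖ *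
          ‖(Matrix.diagonal (φ i) : Matrix (Fin L) (Fin L) ℂ)‖ + C i * ‖X - P‖) := by
          have := hRn i
          gcongr
      _ = c i * ‖X - P‖ * ‖X - P‖ := by simp only [c]; ring
      _ ≤ _ := mul_le_mul_of_nonneg_right (hcX i).le hn
  rw [hR i]
  set a := (E⁻¹ * (Matrix.diagonal (φ i) + R i) * E) (σ l) (σ l)
  set b := (pinv (J₁ i * P) * (J₂ i * (X - P) - J₁ i * (X - P) * Matrix.diagonal (φ i))) l l
  calc ‖a - φ i l - b‖ = ‖(a - φ i l - R i l l) + (R i l l - b)‖ := by congr 1; ring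
    _ ≤ ‖a - φ i l - R i l l‖ + ‖R i l l - b‖ := norm_add_le _ _
    _ ≤ ε / 2 * ‖X - P‖ + ε / 2 * ‖X - P‖ := add_le_add (h1.trans h3) h2
    _ = _ := by ring

end JointDiagonalization

/-! ### Second-order control of a basis of the estimated signal subspace. -/

section SignalSubspace

open scoped Matrix.Norms.L2Operator

variable {L : ℕ} {m n : Type*} [Fintype m] [DecidableEq m] [Fintype n] [DecidableEq n]

/-- The right inverse `W` of `Y` singles out the basis close to `P`. The residual of the truncated
SVD enters as `R * W`; writing `W = (P * Y)ᴴ * V` and `P * Y = A - (A - P * Y)` turns it into two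
products of small factors, which explains the constant `2`. -/
theorem IsLeadingLeft.exists_basis_near {P : Matrix m (Fin L) ℂ} {Y : Matrix (Fin L) n ℂ}
    {W : Matrix n (Fin L) ℂ} {V : Matrix m (Fin L) ℂ} (hYW : Y * W = 1) (hWV : W = (P * Y)ᴴ * V)
    {A : Matrix m n ℂ} {Us : Matrix m (Fin L) ℂ} (h : IsLeadingLeft A Us) :
    ∃ C : Matrix (Fin L) (Fin L) ℂ,
      ‖Us * C - (P + (A - P * Y) * W)‖ ≤ 2 * ‖V‖ * ‖A - P * Y‖ ^ 2 := by
  obtain ⟨S, R, hA, hRA, hR⟩ := h.exists_truncation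
  have hRn := hR P Y
  refine ⟨S * W, ?_⟩
  have h1 : Us * (S * W) - (P + (A - P * Y) * W) = -(R * W) := by
    have h2 : P * Y * W = P := by rw [Matrix.mul_assoc, hYW, Matrix.mul_one]
    rw [← Matrix.mul_assoc, Matrix.sub_mul, h2, add_sub_cancel]
    conv_lhs => rw [hA]
    rw [Matrix.add_mul]
    abel
  have h3 : R * W = R * Rᴴ * V - R * (A - P * Y)ᴴ * V := by
    rw [← hRA, ← Matrix.sub_mul, ← Matrix.mul_sub, Matrix.conjTranspose_sub, sub_sub_cancel,
      Matrix.mul_assoc, ← hWV]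
  rw [h1, norm_neg, h3]
  have hRR : ‖R * Rᴴ‖ ≤ ‖A - P * Y‖ ^ 2 := by
    refine (Matrix.l2_opNorm_mul _ _).trans ?_
    rw [Matrix.l2_opNorm_conjTranspose, pow_two]
    exact mul_le_mul hRn hRn (norm_nonneg _) (norm_nonneg _)
  have hRD : ‖R * (A - P * Y)ᴴ‖ ≤ ‖A - P * Y‖ ^ 2 := by
    refine (Matrix.l2_opNorm_mul _ _).trans ?_
    rw [Matrix.l2_opNorm_conjTranspose, pow_two]
    exact mul_le_mul_of_nonneg_right hRn (norm_nonneg _)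
  have h4 := (Matrix.l2_opNorm_mul (R * Rᴴ) V).trans (mul_le_mul_of_nonneg_right hRR (norm_nonneg _))
  have h5 := (Matrix.l2_opNorm_mul (R * (A - P * Y)ᴴ) V).trans
    (mul_le_mul_of_nonneg_right hRD (norm_nonneg _))
  refine (norm_sub_le _ _).trans ?_
  linarith

end SignalSubspace

/-! ### Independence of the basis, and passage from the subspace to the eigenvalues. -/

section Subspace

/-- Invertibility of `C` is not assumed: the determinant of the Gram matrix of `J₁ U C` contains
`det C` as a factor. -/
theorem pinv_mul_eq_conj {L : ℕ} {m r : Type*} [Fintype m] [Fintype r] {J₁ J₂ : Matrix r m ℂ}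
    {U : Matrix m (Fin L) ℂ} {C : Matrix (Fin L) (Fin L) ℂ}
    (h : IsUnit ((J₁ * (U * C))ᴴ * (J₁ * (U * C)))) :
    IsUnit C ∧ pinv (J₁ * U) * (J₂ * U) =
      C * (pinv (J₁ * (U * C)) * (J₂ * (U * C))) * C⁻¹ := by
  have h1 : (J₁ * (U * C))ᴴ * (J₁ * (U * C)) = Cᴴ * ((J₁ * U)ᴴ * (J₁ * U)) * C := by
    simp only [Matrix.conjTranspose_mul, Matrix.mul_assoc]
  have h2 := (Matrix.isUnit_iff_isUnit_det _).1 h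
  rw [h1, Matrix.det_mul, Matrix.det_mul] at h2
  have hCd : IsUnit C.det := isUnit_of_mul_isUnit_right h2
  have hC : IsUnit C := (Matrix.isUnit_iff_isUnit_det _).2 hCd
  have hU : IsUnit ((J₁ * U)ᴴ * (J₁ * U)) := (Matrix.isUnit_iff_isUnit_det _).2
    (isUnit_of_mul_isUnit_right (isUnit_of_mul_isUnit_left h2))
  refine ⟨hC, ?_⟩
  rw [← Matrix.mul_assoc J₁, ← Matrix.mul_assoc J₂, pinv_mul_of_isUnit hU hC]
  calc _ = (C * C⁻¹) * (pinv (J₁ * U) * (J₂ * U)) * (C * C⁻¹) := by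
        rw [Matrix.mul_nonsing_inv _ hCd, Matrix.one_mul, Matrix.mul_one]
    _ = _ := by simp only [Matrix.mul_assoc]

open scoped Matrix.Norms.L2Operator

variable {L : ℕ} {m n ι : Type*} {r : ι → Type*} [Fintype m] [DecidableEq m] [Fintype n]
  [DecidableEq n] [Fintype ι] [Nonempty ι] [∀ i, Fintype (r i)] [∀ i, DecidableEq (r i)]
  {V : Type*} [NormedAddCommGroup V] [NormedSpace ℂ V] [FiniteDimensional ℂ V]

/-- First-order perturbation of the eigenvalues produced by the jointly diagonalized least-squares
solutions on the leading left singular subspace of `P Y + S x`, as `x → 0`. -/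
theorem eventually_subspace_eigenvalues {J₁ J₂ : (i : ι) → Matrix (r i) m ℂ}
    {P : Matrix m (Fin L) ℂ} {Y : Matrix (Fin L) n ℂ} {W : Matrix n (Fin L) ℂ}
    {Z : Matrix m (Fin L) ℂ} {φ : ι → Fin L → ℂ} (S : V →ₗ[ℂ] Matrix m n ℂ) (β : ι → ℂ)
    (hYW : Y * W = 1) (hWZ : W = (P * Y)ᴴ * Z)
    (hP : ∀ i, J₂ i * P = J₁ i * P * Matrix.diagonal (φ i))
    (hu : ∀ i, IsUnit ((J₁ i * P)ᴴ * (J₁ i * P)))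
    (hβ : Function.Injective fun l => ∑ i, β i * φ i l) {ε : ℝ} (hε : 0 < ε) :
    ∀ᶠ x in 𝓝 (0 : V), (∃ U : Matrix m (Fin L) ℂ, IsLeadingLeft (P * Y + S x) U) ∧
      ∀ U : Matrix m (Fin L) ℂ, IsLeadingLeft (P * Y + S x) U →
      (∃ (E : Matrix (Fin L) (Fin L) ℂ) (d : Fin L → ℂ), IsUnit E ∧
        ∑ i, β i • (pinv (J₁ i * U) * (J₂ i * U)) = E * Matrix.diagonal d * E⁻¹) ∧
      ∀ (E : Matrix (Fin L) (Fin L) ℂ) (d : Fin L → ℂ), IsUnit E →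
        ∑ i, β i • (pinv (J₁ i * U) * (J₂ i * U)) = E * Matrix.diagonal d * E⁻¹ →
        ∃ σ : Equiv.Perm (Fin L), ∀ i l,
          ‖(E⁻¹ * (pinv (J₁ i * U) * (J₂ i * U)) * E) (σ l) (σ l) - φ i l -
            (pinv (J₁ i * P) * (J₂ i * (S x * W) - J₁ i * (S x * W) * Matrix.diagonal (φ i))) l l‖ ≤
            ε * ‖x‖ := by
  set T := LinearMap.toContinuousLinearMap S with hT
  have hSx : ∀ x, ‖S x‖ ≤ ‖T‖ * ‖x‖ := fun x => T.le_opNorm x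
  have hT0 : 0 ≤ ‖T‖ := T.opNorm_nonneg
  -- Lipschitz constant for `U * C - P`: the linear part contributes `‖T‖ * ‖W‖`, and the quadratic
  -- remainder at most `‖x‖` once `w * ‖x‖ < 1`.
  set q : ℝ := ‖T‖ * ‖W‖ + 1 with hq
  have hq0 : 0 < q := by positivity
  set w : ℝ := 2 * ‖Z‖ * ‖T‖ ^ 2 with hw
  have hw0 : 0 ≤ w := by positivity
  let K : ι → ℝ := fun i => ‖pinv (J₁ i * P)‖ *
    (‖J₂ i‖ + ‖J₁ i‖ * ‖(Matrix.diagonal (φ i) : Matrix (Fin L) (Fin L) ℂ)‖)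
  have hK : ∀ i, 0 ≤ K i := fun i => by positivity
  obtain ⟨η, hη, hjoint⟩ := Metric.eventually_nhds_iff.1
    (eventually_joint_diagonalization β hP hu hβ (ε := ε / (2 * q)) (by positivity))
  have hx0 : ∀ k ρ : ℝ, 0 < ρ → ∀ᶠ x in 𝓝 (0 : V), k * ‖x‖ < ρ := by
    intro k ρ hρ
    have h : Continuous fun x : V => k * ‖x‖ := by fun_prop
    have h' := h.tendsto 0
    simp only [norm_zero, mul_zero] at h'
    exact h'.eventually (gt_mem_nhds hρ)
  obtain ⟨i₀⟩ := ‹Nonempty ι›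
  have hPl : pinv (J₁ i₀ * P) * J₁ i₀ * (P * Y) * W = 1 := by
    calc _ = pinv (J₁ i₀ * P) * (J₁ i₀ * P) * (Y * W) := by simp only [Matrix.mul_assoc]
      _ = 1 := by rw [hYW, pinv_mul_self_of_isUnit (hu i₀), Matrix.one_mul]
  have hrank : ∀ᶠ x in 𝓝 (0 : V), L ≤ (P * Y + S x).rank := by
    have hc : Continuous fun x : V => P * Y + S x := continuous_const.add T.continuous
    have h' := hc.tendsto 0
    simp only [map_zero, add_zero] at h'
    exact h'.eventually (eventually_le_rank hPl)
  filter_upwards [hx0 w 1 one_pos, hx0 q η hη, hrank,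
    Filter.eventually_all.2 fun i => hx0 (K i * w) (ε / 2) (by positivity)] with x hx1 hxη hxr hxK
  refine ⟨exists_isLeadingLeft hxr, fun U hU => ?_⟩
  obtain ⟨C, hC⟩ := hU.exists_basis_near hYW hWZ
  rw [add_sub_cancel_left] at hC
  have hx := norm_nonneg x
  have hrem : ‖U * C - (P + S x * W)‖ ≤ w * ‖x‖ * ‖x‖ := by
    refine hC.trans ?_
    calc 2 * ‖Z‖ * ‖S x‖ ^ 2 ≤ 2 * ‖Z‖ * (‖T‖ * ‖x‖) ^ 2 := by
          have := hSx x
          gcongr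
      _ = _ := by rw [hw]; ring
  have hnear : ‖U * C - P‖ ≤ q * ‖x‖ := by
    have h1 : U * C - P = S x * W + (U * C - (P + S x * W)) := by abel
    have h2 : ‖S x * W‖ ≤ ‖T‖ * ‖x‖ * ‖W‖ := (Matrix.l2_opNorm_mul _ _).trans
      (mul_le_mul_of_nonneg_right (hSx x) (norm_nonneg _))
    have h3 : w * ‖x‖ * ‖x‖ ≤ 1 * ‖x‖ := mul_le_mul_of_nonneg_right hx1.le hx
    calc ‖U * C - P‖ ≤ ‖S x * W‖ + ‖U * C - (P + S x * W)‖ := by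
          conv_lhs => rw [h1]
          exact norm_add_le _ _
      _ ≤ ‖T‖ * ‖x‖ * ‖W‖ + 1 * ‖x‖ := add_le_add h2 (hrem.trans h3)
      _ = q * ‖x‖ := by rw [hq]; ring
  obtain ⟨hUC, ⟨E₁, d₁, hE₁, hd₁⟩, hall⟩ := hjoint (y := U * C)
    (by rw [dist_eq_norm]; exact hnear.trans_lt hxη)
  have hCu : IsUnit C := (pinv_mul_eq_conj (J₂ := J₂ i₀) (hUC i₀)).1
  have hCd := (Matrix.isUnit_iff_isUnit_det _).1 hCu
  have hΓ := fun i => (pinv_mul_eq_conj (J₂ := J₂ i) (hUC i)).2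
  have hsum : ∑ i, β i • (pinv (J₁ i * U) * (J₂ i * U)) =
      C * (∑ i, β i • (pinv (J₁ i * (U * C)) * (J₂ i * (U * C)))) * C⁻¹ := by
    rw [Finset.mul_sum, Finset.sum_mul]
    refine Finset.sum_congr rfl fun i _ => ?_
    rw [hΓ i, Matrix.mul_smul, Matrix.smul_mul]
  refine ⟨⟨C * E₁, d₁, hCu.mul hE₁, ?_⟩, fun E d hE hEd => ?_⟩
  · rw [hsum, hd₁, Matrix.mul_inv_rev]
    simp only [Matrix.mul_assoc]
  have hinv : (C⁻¹ * E)⁻¹ = E⁻¹ * C := by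
    rw [Matrix.mul_inv_rev, Matrix.nonsing_inv_nonsing_inv _ hCd]
  -- Eigenvectors in the basis `U` become `C⁻¹ * E` in the basis `U * C`, with the same conjugated
  -- matrices.
  obtain ⟨σ, hσ⟩ := hall (C⁻¹ * E) d ((Matrix.isUnit_nonsing_inv_iff.2 hCu).mul hE) (by
    rw [hinv]
    calc _ = C⁻¹ * (∑ i, β i • (pinv (J₁ i * U) * (J₂ i * U))) * C := by
          rw [hsum]
          calc _ = (C⁻¹ * C) * (∑ i, β i • (pinv (J₁ i * (U * C)) * (J₂ i * (U * C)))) *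
                (C⁻¹ * C) := by rw [Matrix.nonsing_inv_mul _ hCd, Matrix.one_mul, Matrix.mul_one]
            _ = _ := by simp only [Matrix.mul_assoc]
      _ = _ := by rw [hEd]; simp only [Matrix.mul_assoc])
  refine ⟨σ, fun i l => ?_⟩
  have h1 := hσ i l
  have hconj : (C⁻¹ * E)⁻¹ * (pinv (J₁ i * (U * C)) * (J₂ i * (U * C))) * (C⁻¹ * E) =
      E⁻¹ * (pinv (J₁ i * U) * (J₂ i * U)) * E := by
    rw [hinv, hΓ i]
    simp only [Matrix.mul_assoc]
  rw [hconj] at h1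
  set a := (E⁻¹ * (pinv (J₁ i * U) * (J₂ i * U)) * E) (σ l) (σ l)
  set D : Matrix (Fin L) (Fin L) ℂ := Matrix.diagonal (φ i) with hD
  have hlin : pinv (J₁ i * P) * (J₂ i * (U * C - P) - J₁ i * (U * C - P) * D) =
      pinv (J₁ i * P) * (J₂ i * (S x * W) - J₁ i * (S x * W) * D) +
      pinv (J₁ i * P) * (J₂ i * (U * C - (P + S x * W)) - J₁ i * (U * C - (P + S x * W)) * D) := by
    rw [← Matrix.mul_add]
    congr 1
    have : U * C - P = S x * W + (U * C - (P + S x * W)) := by abel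
    conv_lhs => rw [this]
    rw [Matrix.mul_add, Matrix.mul_add, Matrix.add_mul]
    abel
  rw [hlin, Matrix.add_apply] at h1
  have h2 : ‖(pinv (J₁ i * P) * (J₂ i * (U * C - (P + S x * W)) -
      J₁ i * (U * C - (P + S x * W)) * D)) l l‖ ≤ ε / 2 * ‖x‖ := by
    refine (norm_entry_le_l2_opNorm _ l l).trans ((Matrix.l2_opNorm_mul _ _).trans ?_)
    calc _ ≤ ‖pinv (J₁ i * P)‖ * ((‖J₂ i‖ + ‖J₁ i‖ * ‖D‖) * (w * ‖x‖ * ‖x‖)) :=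
          mul_le_mul_of_nonneg_left ((norm_mul_sub_mul_diagonal_le _ _ _ _).trans
            (mul_le_mul_of_nonneg_left hrem (by positivity))) (norm_nonneg _)
      _ = K i * w * ‖x‖ * ‖x‖ := by simp only [K]; ring
      _ ≤ ε / 2 * ‖x‖ := mul_le_mul_of_nonneg_right (hxK i).le hx
  have h3 : ε / (2 * q) * ‖U * C - P‖ ≤ ε / 2 * ‖x‖ := by
    calc _ ≤ ε / (2 * q) * (q * ‖x‖) := mul_le_mul_of_nonneg_left hnear (by positivity)
      _ = _ := by field_simp
  set b := (pinv (J₁ i * P) * (J₂ i * (S x * W) - J₁ i * (S x * W) * D)) l l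
  set e := (pinv (J₁ i * P) * (J₂ i * (U * C - (P + S x * W)) -
      J₁ i * (U * C - (P + S x * W)) * D)) l l
  calc ‖a - φ i l - b‖ = ‖(a - φ i l - (b + e)) + e‖ := by congr 1; ring
    _ ≤ ‖a - φ i l - (b + e)‖ + ‖e‖ := norm_add_le _ _
    _ ≤ ε / 2 * ‖x‖ + ε / 2 * ‖x‖ := add_le_add (h1.trans h3) h2
    _ = _ := by ring

end Subspace

/-! ### Application to the smoothed channel. -/

section Perturbation

variable {N M : Fin 4 → ℕ} {L K₅ L₅ M₅ : ℕ}

/-- Frequency smoothing as a linear map. -/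
noncomputable def smoothLinearMap (N : Fin 4 → ℕ) (K₅ L₅ M₅ : ℕ) :
    (BeamIdx N × Fin M₅ → ℂ) →ₗ[ℂ] Matrix (BeamIdx N × Fin K₅) (Fin L₅) ℂ where
  toFun := smooth K₅ L₅
  map_add' := smooth_add
  map_smul' := smooth_smul

/-- On the entry `(l, l)`, right multiplication by the two diagonal matrices contributes only the
scalars `(γ l)⁻¹` and `phase ω n l`, matching the abstract first-order term. -/
theorem bilinearPerturbation_eq_diag_entry
    (T : (j : Fin 4) → Matrix (Fin (M j)) (Fin (N j)) ℂ)
    (F Q : (j : Fin 4) → Matrix (Fin (N j)) (Fin (N j)) ℂ)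
    (ω : Mode → Fin L → ℝ) (γ : Fin L → ℂ) (n : Mode) (l : Fin L)
    (Δh : BeamIdx N × Fin M₅ → ℂ) :
    bilinearPerturbation T F Q ω γ K₅ L₅ n l Δh =
      (pinv (selOne Q K₅ n * manifold T ω K₅) *
        (selTwo F Q K₅ n * (smooth K₅ L₅ Δh *
            (pinv (steering L₅ (ω none))ᵀ * Matrix.diagonal fun l => (γ l)⁻¹)) -
          selOne Q K₅ n * (smooth K₅ L₅ Δh *
            (pinv (steering L₅ (ω none))ᵀ * Matrix.diagonal fun l => (γ l)⁻¹)) *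
            Matrix.diagonal (phase ω n))) l l := by
  set A := pinv (selOne Q K₅ n * manifold T ω K₅)
  set G := pinv (steering L₅ (ω none))ᵀ
  set S : Matrix (BeamIdx N × Fin K₅) (Fin L₅) ℂ := smooth K₅ L₅ Δh
  have h1 : A * (selTwo F Q K₅ n * (S * (G * Matrix.diagonal fun l => (γ l)⁻¹)) -
      selOne Q K₅ n * (S * (G * Matrix.diagonal fun l => (γ l)⁻¹)) * Matrix.diagonal (phase ω n)) =
      A * selTwo F Q K₅ n * S * G * Matrix.diagonal (fun l => (γ l)⁻¹) -
      A * selOne Q K₅ n * S * G * Matrix.diagonal (fun l => (γ l)⁻¹) *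
        Matrix.diagonal (phase ω n) := by
    rw [Matrix.mul_sub]
    simp only [Matrix.mul_assoc]
  have h2 : A * (selTwo F Q K₅ n - phase ω n l • selOne Q K₅ n) * S * G =
      A * selTwo F Q K₅ n * S * G - phase ω n l • (A * selOne Q K₅ n * S * G) := by
    simp only [Matrix.mul_sub, Matrix.sub_mul, Matrix.mul_smul, Matrix.smul_mul]
  rw [h1, Matrix.sub_apply, Matrix.mul_diagonal, Matrix.mul_diagonal, Matrix.mul_diagonal,
    bilinearPerturbation, h2, single_one_dotProduct, Matrix.mulVec_single_one, Matrix.col_apply,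
    Matrix.sub_apply, Matrix.smul_apply, smul_eq_mul]
  ring

theorem isFirstOrderPerturbation_bilinear (hM₅ : L₅ + K₅ = M₅ + 1)
    (T : (j : Fin 4) → Matrix (Fin (M j)) (Fin (N j)) ℂ)
    (F Q : (j : Fin 4) → Matrix (Fin (N j)) (Fin (N j)) ℂ)
    (ω : Mode → Fin L → ℝ) (γ : Fin L → ℂ) (hγ : ∀ l, γ l ≠ 0) (β : Mode → ℂ)
    (hshift : ∀ j, IsShiftInvariant (T j) (F j) (Q j))
    (hP : ∀ n, (selOne Q K₅ n * manifold T ω K₅).rank = L)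
    (hG : (steering L₅ (ω none)).rank = L)
    (hβ : Function.Injective (fun l => ∑ n, β n * phase ω n l)) :
    IsFirstOrderPerturbation K₅ L₅ F Q β (channel T ω γ M₅) (phase ω)
      (fun n l Δh => bilinearPerturbation T F Q ω γ K₅ L₅ n l Δh) := by
  intro ε hε
  set P := manifold T ω K₅
  set G := (steering L₅ (ω none))ᵀ with hGdef
  have hGG : G * pinv G = 1 := transpose_mul_pinv_of_rank hG
  have hPP : pinv P * P = 1 := by
    -- A left inverse of `selOne Q K₅ n * P` for a single mode already gives one of `P`; the
    -- frequency mode is an arbitrary choice.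
    obtain ⟨B, hB⟩ := exists_left_inverse_of_rank (hP none)
    rw [← Matrix.mul_assoc] at hB
    exact pinv_mul_self_of_left_inverse hB
  have hu : ∀ n, IsUnit ((selOne Q K₅ n * P)ᴴ * (selOne Q K₅ n * P)) := fun n => by
    obtain ⟨B, hB⟩ := exists_left_inverse_of_rank (hP n)
    exact isUnit_conjTranspose_mul_self hB
  have hYW : (Matrix.diagonal γ * G) * (pinv G * Matrix.diagonal fun l => (γ l)⁻¹) = 1 := by
    calc _ = Matrix.diagonal γ * (G * pinv G) * Matrix.diagonal (fun l => (γ l)⁻¹) := by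
          simp only [Matrix.mul_assoc]
      _ = 1 := by rw [hGG, Matrix.mul_one, Matrix.diagonal_mul_diagonal]; simp [hγ]
  -- The range of `pinv G` lies in that of `Gᴴ`, and `Gᴴ` is recovered from `(P * (diagonal γ *
  -- G))ᴴ` by cancelling the left-invertible `P` and the invertible `diagonal γ`.
  have hWZ : (pinv G * Matrix.diagonal fun l => (γ l)⁻¹) = (P * (Matrix.diagonal γ * G))ᴴ *
      ((pinv P)ᴴ * ((Matrix.diagonal fun l => (γ l)⁻¹)ᴴ * ((pinv G)ᴴ * pinv G) *
        Matrix.diagonal fun l => (γ l)⁻¹)) := by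
    have h1 : Pᴴ * (pinv P)ᴴ = 1 := by
      rw [← Matrix.conjTranspose_mul, hPP, Matrix.conjTranspose_one]
    have h2 : (Matrix.diagonal γ)ᴴ * (Matrix.diagonal fun l => (γ l)⁻¹)ᴴ = 1 := by
      rw [← Matrix.conjTranspose_mul, Matrix.diagonal_mul_diagonal]
      simp [hγ]
    calc _ = Gᴴ * ((pinv G)ᴴ * pinv G) * Matrix.diagonal (fun l => (γ l)⁻¹) := by
          rw [← pinv_eq_conjTranspose_mul]
      _ = Gᴴ * (((Matrix.diagonal γ)ᴴ * (Pᴴ * (pinv P)ᴴ) *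
            (Matrix.diagonal fun l => (γ l)⁻¹)ᴴ) * ((pinv G)ᴴ * pinv G)) *
            Matrix.diagonal (fun l => (γ l)⁻¹) := by
          rw [h1, Matrix.mul_one, h2, Matrix.one_mul]
      _ = _ := by simp only [Matrix.conjTranspose_mul, Matrix.mul_assoc]
  have hmain := eventually_subspace_eigenvalues (smoothLinearMap N K₅ L₅ M₅) β hYW hWZ
    (selTwo_mul_manifold T F Q ω hshift) hu hβ hε
  filter_upwards [hmain] with Δh hΔ
  have hS : smooth K₅ L₅ (channel T ω γ M₅ + Δh) =
      P * (Matrix.diagonal γ * G) + smoothLinearMap N K₅ L₅ M₅ Δh := by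
    rw [smooth_add, smooth_channel hM₅, Matrix.mul_assoc]
    rfl
  rw [← hS] at hΔ
  obtain ⟨⟨U, hU⟩, hall⟩ := hΔ
  refine ⟨?_, ?_⟩
  · obtain ⟨⟨E, d, hE, hEd⟩, -⟩ := hall U hU
    exact ⟨fun n l => (E⁻¹ * gammaMat F Q U n * E) l l, U, E, d, hU, hE, hEd, fun _ _ => rfl⟩
  · rintro Ψ ⟨U', E, d, hU', hE, hEd, hΨ⟩
    obtain ⟨σ, hσ⟩ := (hall U' hU').2 E d hE hEd
    refine ⟨σ, fun n l => ?_⟩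
    rw [hΨ, bilinearPerturbation_eq_diag_entry]
    exact hσ n l

end Perturbation

end BeamspaceESPRIT

theorem proposition3 {N M : Fin 4 → ℕ} {L K₅ L₅ M₅ : ℕ} (hM₅ : L₅ + K₅ = M₅ + 1)
    (T : (j : Fin 4) → Matrix (Fin (M j)) (Fin (N j)) ℂ)
    (F Q : (j : Fin 4) → Matrix (Fin (N j)) (Fin (N j)) ℂ)
    (ω : BeamspaceESPRIT.Mode → Fin L → ℝ) (γ : Fin L → ℂ) (hγ : ∀ l, γ l ≠ 0) :
    (∀ (n : BeamspaceESPRIT.Mode) (l : Fin L) (Δh : BeamspaceESPRIT.BeamIdx N × Fin M₅ → ℂ),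
      BeamspaceESPRIT.bilinearPerturbation T F Q ω γ K₅ L₅ n l Δh =
        (star (BeamspaceESPRIT.xi T F Q ω K₅ L₅ M₅ n l) ⬝ᵥ Δh) / γ l) ∧
    ∀ β : BeamspaceESPRIT.Mode → ℂ,
      (∀ j, BeamspaceESPRIT.IsShiftInvariant (T j) (F j) (Q j)) →
      (∀ n, (BeamspaceESPRIT.selOne Q K₅ n * BeamspaceESPRIT.manifold T ω K₅).rank = L) →
      (BeamspaceESPRIT.steering L₅ (ω none)).rank = L →
      Function.Injective (fun l => ∑ n, β n * BeamspaceESPRIT.phase ω n l) →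
      BeamspaceESPRIT.IsFirstOrderPerturbation K₅ L₅ F Q β
        (BeamspaceESPRIT.channel T ω γ M₅) (BeamspaceESPRIT.phase ω)
        (fun n l Δh => (star (BeamspaceESPRIT.xi T F Q ω K₅ L₅ M₅ n l) ⬝ᵥ Δh) / γ l) := by
  refine ⟨BeamspaceESPRIT.bilinearPerturbation_eq hM₅ T F Q ω γ, fun β hshift hP hG hβ => ?_⟩
  have h := BeamspaceESPRIT.isFirstOrderPerturbation_bilinear hM₅ T F Q ω γ hγ β hshift hP hG hβ
  simpa only [BeamspaceESPRIT.bilinearPerturbation_eq hM₅] using h
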